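/- Let $X$ and $Y$ be $\sigma$-compact metric spaces with their Borel $\sigma$-algebras, and let $\sigma$ on $X$ and $\mu$ on $Y$ be diffuse Borel measures that are finite on compact sets. Let $\Omega^X$ be the space of configurations on $X$, i.e. of locally finite subsets $\omega\subset X$, each identified with the point measure $\omega=\sum_{x\in\omega}\epsilon_x$, where $\epsilon_x$ is the Dirac measure at $x$; equip $\Omega^X$ with the $\sigma$-algebra generated by the maps $\omega\mapsto\omega(B)$, $B$ Borel, and define $\Omega^Y$ in the same way. Let $\pi_\sigma$ be the Poisson measure with intensity $\sigma$, i.e. the probability measure on $\Omega^X$ under which, for all pairwise disjoint compact sets $A_1,\dots,A_n\subset X$, the random variables $\omega(A_1),\dots,\omega(A_n)$ are independent and Poisson distributed with parameters $\sigma(A_1),\dots,\sigma(A_n)$; define $\pi_\mu$ on $\Omega^Y$ in the same way. Let $\tau:\Omega^X\times X\to Y$ be a measurable map such that $$\tau(\omega,\cdot)_*\sigma=\mu\qquad\text{for every }\omega\in\Omega^X,$$ and which satisfies the cyclic condition $$D_{t_1}\tau(\omega,t_2)\,D_{t_2}\tau(\omega,t_3)\cdots D_{t_k}\tau(\omega,t_1)=0\qquad\text{for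 all }k\ge 1,\ \omega\in\Omega^X,\ t_1,\dots,t_k\in X,$$ which means that, with $t_{k+1}=t_1$, there is $i\in\{1,\dots,k\}$ such that $\tau(\omega\cup\{t_i\},t_{i+1})=\tau(\omega,t_{i+1})$. Let $$\tau_*(\omega)=\sum_{x\in\omega}\epsilon_{\tau(\omega,x)},\qquad \omega\in\Omega^X.$$ Then $\tau_*(\omega)\in\Omega^Y$ for $\pi_\sigma$-almost every $\omega$, and $\tau_*$ maps $\pi_\sigma$ to $\pi_\mu$, i.e. $\tau_*\pi_\sigma=\pi_\mu$ is the Poisson measure on $Y$ with intensity $\mu$. -/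

import Mathlib

open MeasureTheory ProbabilityTheory

/-- The configuration space over `X`: subsets of `X` with finitely many points in each compact set.
In a metric space this is the same as local finiteness, and in a σ-compact space such a set is
automatically at most countable. -/
@[ext]
structure Config (X : Type*) [TopologicalSpace X] where
  carrier : Set X
  finite_inter : ∀ K : Set X, IsCompact K → (carrier ∩ K).Finite

namespace Config

section Topological

variable {X Y : Type*} [TopologicalSpace X] [TopologicalSpace Y]

/-- The empty configuration. -/
def empty : Config X where
  carrier := ∅
  finite_inter := fun K _ => by simp

/-- The configuration `ω ∪ {x}`. -/
def add (ω : Config X) (x : X) : Config X where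
  carrier := ω.carrier ∪ {x}
  finite_inter := fun K hK =>
    ((ω.finite_inter K hK).union (Set.finite_singleton x)).subset (by
      rintro y ⟨hy | hy, hyK⟩
      · exact Or.inl ⟨hy, hyK⟩
      · exact Or.inr hy)

/-- The number `ω(A)` of points of `ω` in `A`, used for compact sets `A`, where it is finite. -/
noncomputable def count (A : Set X) (ω : Config X) : ℕ := (ω.carrier ∩ A).ncard

open Classical in
/-- The map `τ_*` between configuration spaces induced by `τ`: it moves each `x ∈ ω` to `τ ω x`.
If two points of `ω` collide or if the image is not locally finite, then the image is not a
configuration on `Y` and the value is the empty configuration by convention. -/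
noncomputable def push (τ : Config X → X → Y) (ω : Config X) : Config Y :=
  if h : Set.InjOn (τ ω) ω.carrier ∧
      ∀ K : Set Y, IsCompact K → ((τ ω '' ω.carrier) ∩ K).Finite then
    ⟨τ ω '' ω.carrier, h.2⟩
  else empty

/-- `D_s τ(ω, t) = 0`, i.e. `τ(ω ∪ {s}, t) = τ(ω, t)`. -/
def DiffVanishes (τ : Config X → X → Y) (s : X) (ω : Config X) (t : X) : Prop :=
  τ (ω.add s) t = τ ω t

/-- The cyclic condition `D_{t₁} τ(ω, t₂) ⋯ D_{t_k} τ(ω, t₁) = 0` for all `k ≥ 1`, all `ω` and all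
`t₁, …, t_k`: at least one of the factors vanishes. Here `k = m + 1`, and the addition `i + 1` in
`Fin (m + 1)` is cyclic. -/
def CyclicCondition (τ : Config X → X → Y) : Prop :=
  ∀ (m : ℕ) (ω : Config X) (t : Fin (m + 1) → X),
    ∃ i : Fin (m + 1), DiffVanishes τ (t i) ω (t (i + 1))

end Topological

section Measurable

variable {X Y : Type*} [TopologicalSpace X] [MeasurableSpace X]

/-- The point measure `∑_{x ∈ ω} ε_x`. -/
noncomputable def toMeasure (ω : Config X) : Measure X :=
  Measure.sum fun x : ω.carrier => Measure.dirac (x : X)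

/-- The image measure `∑_{x ∈ ω} ε_{τ(ω, x)}`, with multiplicities. -/
noncomputable def imageMeasure [MeasurableSpace Y] (τ : Config X → X → Y) (ω : Config X) :
    Measure Y :=
  Measure.sum fun x : ω.carrier => Measure.dirac (τ ω x)

/-- The σ-algebra on the configuration space generated by the maps `ω ↦ ω(B)`, `B` measurable. -/
noncomputable instance instMeasurableSpace : MeasurableSpace (Config X) :=
  MeasurableSpace.comap toMeasure inferInstance

/-- `P` is the Poisson measure with intensity `σ`: it is a probability measure on the configuration
space under which, for all pairwise disjoint compact sets `A₁, …, A_n`, the random variables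
`ω(A₁), …, ω(A_n)` are independent and Poisson distributed with parameters
`σ(A₁), …, σ(A_n)`. -/
structure IsPoissonMeasure (σ : Measure X) (P : Measure (Config X)) : Prop where
  isProbabilityMeasure : IsProbabilityMeasure P
  hasLaw_count : ∀ A : Set X, IsCompact A →
    HasLaw (count A) (poissonMeasure (σ A).toNNReal) P
  iIndepFun_count : ∀ (n : ℕ) (A : Fin n → Set X), (∀ i, IsCompact (A i)) →
    Pairwise (fun i j => Disjoint (A i) (A j)) → iIndepFun (fun i => count (A i)) P

end Measurable

end Config

open scoped ENNReal NNReal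

set_option linter.unusedSectionVars false

/-! A law on configurations is determined by its generating functional, the expectation of the
product of `h x` over the points, for test functions `h` with values in [0, 1] that equal 1 off a
compact set (`ext_of_integral_gen`). For a Poisson measure of intensity μ this functional is exp(-∫
(1 - h) dμ) (`IsPoissonMeasure.integral_gen`). So the heart of the matter is to compute E ∏_{x ∈ ω}
h(τ(ω, x)), which is `IsPoissonMeasure.integral_finprod_image`.

Put f = 1 - h and m = ∫ f dμ. Expanding the product of the factors 1 - f(τ(ω, x)) gives the sum over
n of (-1)^n / n! times the sum of ∏ f(τ(ω, x_i)) over n-tuples of distinct points of ω. By the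
iterated Mecke formula (`IsPoissonMeasure.lintegral_factSum`), the expectation of the n-th tuple sum
is E ∫ ∏ f(τ(ω ∪ {x_1, …, x_n}, x_i)) dσ^n. The inner integral equals m^n for every ω
(`CyclicCondition.lintegral_prod_addRange`), and the series sums to exp(-m).

The identity with m^n is where the cyclic condition enters. A finite-graph argument shows that for
any added points, some x_i has the same image under ω ∪ {x_1, …, x_n} as under ω
(`CyclicCondition.exists_mem_addFinset_eq`). Hence ∏ (f(τ(ω ∪ x, x_i)) - f(τ(ω, x_i))) vanishes
identically. Expand it over subsets S of factors evaluated at ω. By induction on n every term with S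
nonempty integrates to m^n. The signed number of subsets is zero, so the term S = ∅ integrates to
m^n as well.

That the image is a configuration follows from the smallest cases. With one point, Mecke's formula
gives the image mean measure μ, hence local finiteness. With two points, diffuseness of μ makes the
expected number of colliding pairs zero. -/

namespace Config

/-! ### Cycles and the cyclic condition -/

section Combinatorics

variable {X Y : Type*} [TopologicalSpace X]

/-- The configuration `ω ∪ S` for a finite set `S`. -/
def addFinset (ω : Config X) (S : Finset X) : Config X where
  carrier := ω.carrier ∪ S
  finite_inter := fun K hK =>
    ((ω.finite_inter K hK).union S.finite_toSet).subset (by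
      rintro y ⟨hy | hy, hyK⟩
      · exact Or.inl ⟨hy, hyK⟩
      · exact Or.inr hy)

/-- The configuration `ω ∪ {x i | i}` for a finite family of points. -/
def addRange {ι : Type*} [Finite ι] (ω : Config X) (x : ι → X) : Config X where
  carrier := ω.carrier ∪ Set.range x
  finite_inter := fun K hK =>
    ((ω.finite_inter K hK).union (Set.finite_range x)).subset (by
      rintro y ⟨hy | hy, hyK⟩
      · exact Or.inl ⟨hy, hyK⟩
      · exact Or.inr hy)

@[simp]
lemma carrier_add (ω : Config X) (x : X) : (ω.add x).carrier = ω.carrier ∪ {x} := rfl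

@[simp]
lemma carrier_addFinset (ω : Config X) (S : Finset X) :
    (ω.addFinset S).carrier = ω.carrier ∪ S := rfl

@[simp]
lemma carrier_addRange {ι : Type*} [Finite ι] (ω : Config X) (x : ι → X) :
    (ω.addRange x).carrier = ω.carrier ∪ Set.range x := rfl

/-- A self-map of a nonempty finite type has a cycle. -/
lemma exists_iterate_succ_eq_self {α : Type*} [Finite α] [Nonempty α] (g : α → α) :
    ∃ (p : α) (m : ℕ), g^[m + 1] p = p := by
  obtain ⟨a⟩ := ‹Nonempty α›
  obtain ⟨i, j, hij, h⟩ := Finite.exists_ne_map_eq_of_infinite (fun n : ℕ => g^[n] a)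
  wlog hlt : i < j generalizing i j
  · exact this j i hij.symm h.symm (by omega)
  refine ⟨g^[i] a, j - i - 1, ?_⟩
  rw [← Function.iterate_add_apply, show j - i - 1 + 1 + i = j by omega]
  exact h.symm

/-- Under the cyclic condition, every nonempty finite set of added points contains a point whose
image is not affected by the addition of all these points. -/
lemma CyclicCondition.exists_mem_addFinset_eq {τ : Config X → X → Y} (hτ : CyclicCondition τ)
    (S : Finset X) (hS : S.Nonempty) (ω : Config X) :
    ∃ x ∈ S, τ (ω.addFinset S) x = τ ω x := by
  classical
  induction h : S.card using Nat.strong_induction_on generalizing S ω with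
  | _ n ih =>
  subst h
  by_contra! hcon
  -- If every image is affected, induction applied to `S.erase k` and `ω ∪ {k}` gives a point i
  -- already stable from `ω ∪ {k}` on, so the change at i must come from adding k. This draws an
  -- arrow from each k to some i with D_k τ(ω, i) ≠ 0.
  have key : ∀ k : S, ∃ i : S, ¬ DiffVanishes τ k ω i := by
    rintro ⟨k, hk⟩
    by_cases hS' : (S.erase k).Nonempty
    · obtain ⟨i, hi, h⟩ := ih _ (Finset.card_erase_lt_of_mem hk) (S.erase k) hS' (ω.add k) rfl
      refine ⟨⟨i, Finset.mem_of_mem_erase hi⟩, fun hd => hcon i (Finset.mem_of_mem_erase hi) ?_⟩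
      have : (ω.add k).addFinset (S.erase k) = ω.addFinset S := by
        ext y
        simp only [carrier_addFinset, carrier_add, Finset.coe_erase, Set.mem_union,
          Set.mem_singleton_iff, Set.mem_sdiff, Finset.mem_coe]
        by_cases hy : y = k
        · subst hy; simp [hk]
        · simp [hy]
      rw [← this, h]
      exact hd
    · refine ⟨⟨k, hk⟩, fun hd => hcon k hk ?_⟩
      have : ω.addFinset S = ω.add k := by
        ext y
        have hSk : S = {k} := by
          rw [Finset.not_nonempty_iff_eq_empty] at hS'
          rw [← Finset.insert_erase hk, hS']
          rfl
        simp [hSk]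
      rw [this]
      exact hd
  choose g hg using key
  have : Nonempty S := hS.to_subtype
  obtain ⟨p, m, hp⟩ := exists_iterate_succ_eq_self g
  -- Following the arrows in a finite set closes a cycle, on which no factor vanishes. The last
  -- index needs `hp`, since `i + 1` wraps around to 0.
  obtain ⟨i, hi⟩ := hτ m ω (fun i => (g^[i] p : S))
  refine hg (g^[i] p) ?_
  convert hi using 2
  rw [← Function.iterate_succ_apply' g]
  by_cases him : i = Fin.last m
  · subst him
    simp [hp]
  · rw [Fin.val_add_one_of_lt (Fin.lt_last_iff_ne_last.2 him)]

lemma CyclicCondition.exists_addRange_eq {τ : Config X → X → Y} (hτ : CyclicCondition τ)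
    {ι : Type*} [Finite ι] [Nonempty ι] (ω : Config X) (x : ι → X) :
    ∃ i, τ (ω.addRange x) (x i) = τ ω (x i) := by
  classical
  obtain ⟨y, hy, h⟩ := hτ.exists_mem_addFinset_eq (Set.finite_range x).toFinset
    (by simpa using Set.range_nonempty x) ω
  obtain ⟨i, rfl⟩ : y ∈ Set.range x := by simpa using hy
  refine ⟨i, ?_⟩
  have : ω.addRange x = ω.addFinset (Set.finite_range x).toFinset := by
    ext y; simp
  rw [this, h]

end Combinatorics

/-! ### Measurability on the configuration space -/

section Measurability

variable {X : Type*} [MetricSpace X] [MeasurableSpace X]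

lemma measurable_toMeasure : Measurable (toMeasure : Config X → Measure X) :=
  comap_measurable _

lemma measurable_of_toMeasure {α : Type*} [MeasurableSpace α] {f : α → Config X}
    (hf : Measurable fun a => (f a).toMeasure) : Measurable f :=
  measurable_comap_iff.2 hf

variable [BorelSpace X]

lemma lintegral_toMeasure (ω : Config X) (F : X → ℝ≥0∞) :
    ∫⁻ x, F x ∂ω.toMeasure = ∑' x : ω.carrier, F x := by
  simp [toMeasure, lintegral_sum_measure, lintegral_dirac]

lemma toMeasure_apply (ω : Config X) {B : Set X} (hB : MeasurableSet B) :
    ω.toMeasure B = ((ω.carrier ∩ B).encard : ℝ≥0∞) := by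
  rw [← lintegral_indicator_one hB, lintegral_toMeasure, tsum_subtype, ← ENNReal.tsum_set_one,
    tsum_subtype (ω.carrier ∩ B) (fun _ => (1 : ℝ≥0∞)), ← Set.indicator_indicator]
  rfl

/-- Measurable sets contained in a compact set. -/
def Bdd (B : Set X) : Prop := MeasurableSet B ∧ ∃ K : Set X, IsCompact K ∧ B ⊆ K

lemma Bdd.of_isCompact {K : Set X} (hK : IsCompact K) : Bdd K :=
  ⟨hK.measurableSet, K, hK, subset_rfl⟩

lemma Bdd.mono {A B : Set X} (hB : Bdd B) (hA : MeasurableSet A) (h : A ⊆ B) : Bdd A :=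
  ⟨hA, hB.2.imp fun _ hK => ⟨hK.1, h.trans hK.2⟩⟩

lemma Bdd.finite_inter {B : Set X} (hB : Bdd B) (ω : Config X) : (ω.carrier ∩ B).Finite := by
  obtain ⟨-, K, hK, hBK⟩ := hB
  exact (ω.finite_inter K hK).subset (Set.inter_subset_inter_right _ hBK)

lemma Bdd.toMeasure_apply {B : Set X} (hB : Bdd B) (ω : Config X) :
    ω.toMeasure B = (count B ω : ℝ≥0∞) := by
  rw [Config.toMeasure_apply ω hB.1, count, ← (hB.finite_inter ω).cast_ncard_eq]
  simp

lemma Bdd.measurable_count {B : Set X} (hB : Bdd B) : Measurable (count B : Config X → ℕ) := by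
  have h : Measurable fun ω : Config X => ω.toMeasure B :=
    (Measure.measurable_coe hB.1).comp measurable_toMeasure
  have h2 : (count B : Config X → ℕ) = fun ω => ⌊(ω.toMeasure B).toNNReal⌋₊ := by
    ext ω
    simp [hB.toMeasure_apply]
  rw [h2]
  exact Nat.measurable_floor.comp h.ennreal_toNNReal

lemma Bdd.measure_lt_top {B : Set X} (hB : Bdd B) (σ : Measure X) [IsFiniteMeasureOnCompacts σ] :
    σ B < ∞ := by
  obtain ⟨-, K, hK, hBK⟩ := hB
  exact (measure_mono hBK).trans_lt hK.measure_lt_top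

variable [SigmaCompactSpace X]

variable (X) in
/-- A partition of `X` into countably many sets contained in compact sets. -/
def piece (n : ℕ) : Set X := disjointed (compactCovering X) n

lemma bdd_piece (n : ℕ) : Bdd (piece X n) :=
  (Bdd.of_isCompact (isCompact_compactCovering X n)).mono
    (MeasurableSet.disjointed (fun n => (isCompact_compactCovering X n).measurableSet) n)
    (disjointed_le _ n)

lemma iUnion_piece : ⋃ n, piece X n = Set.univ := by
  simp only [piece]
  rw [iUnion_disjointed, iUnion_compactCovering]

lemma pairwise_disjoint_piece : Pairwise (Function.onFun Disjoint (piece X)) :=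
  disjoint_disjointed _

lemma sum_restrict_piece (μ : Measure X) : Measure.sum (fun n => μ.restrict (piece X n)) = μ := by
  rw [← Measure.restrict_iUnion pairwise_disjoint_piece (fun n => (bdd_piece n).1), iUnion_piece,
    Measure.restrict_univ]

variable (X) in
/-- The kernel sending a configuration to its point measure. -/
noncomputable def pointKernel : Kernel (Config X) X := ⟨toMeasure, measurable_toMeasure⟩

@[simp]
lemma pointKernel_apply (ω : Config X) : pointKernel X ω = ω.toMeasure := rfl

/-- Cut by the pieces of X and by the number m of points in the piece: each part has mass at most m.
S-finiteness is what makes integrals against `ω.toMeasure` measurable in parameters. -/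
instance : IsSFiniteKernel (pointKernel X) := by
  classical
  have hs : ∀ n m : ℕ, MeasurableSet {ω : Config X | count (piece X n) ω = m} := fun n m =>
    (bdd_piece n).measurable_count (measurableSet_singleton m)
  let κ : ℕ × ℕ → Kernel (Config X) X := fun p =>
    Kernel.piecewise (hs p.1 p.2) ((pointKernel X).restrict (bdd_piece p.1).1) 0
  have hκ : ∀ p, IsFiniteKernel (κ p) := fun p => ⟨(p.2 : ℝ≥0∞), by simp, fun ω => by
    simp only [κ, Kernel.piecewise_apply, Set.mem_ofPred_eq]
    split_ifs with h
    · simp [Kernel.restrict_apply, (bdd_piece p.1).toMeasure_apply, h]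
    · simp⟩
  have : pointKernel X = Kernel.sum κ := by
    ext1 ω
    rw [Kernel.sum_apply, pointKernel_apply, ← sum_restrict_piece ω.toMeasure]
    ext s hs
    rw [Measure.sum_apply _ hs, Measure.sum_apply _ hs,
      ENNReal.tsum_prod (f := fun n m => κ (n, m) ω s)]
    refine tsum_congr fun n => ?_
    rw [tsum_eq_single (count (piece X n) ω)]
    · simp [κ, Kernel.piecewise_apply, Kernel.restrict_apply]
    · intro m hm
      simp [κ, Kernel.piecewise_apply, hm.symm]
  rw [this]
  infer_instance

lemma measurable_lintegral_toMeasure {α : Type*} [MeasurableSpace α] {g : α → Config X}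
    (hg : Measurable g) {F : α → X → ℝ≥0∞} (hF : Measurable (Function.uncurry F)) :
    Measurable fun a => ∫⁻ x, F a x ∂(g a).toMeasure :=
  Measurable.lintegral_kernel_prod_right (κ := (pointKernel X).comap g hg) hF

/-- Membership of x means that the integral of the indicator of the diagonal slice `y = x` against ω
is nonzero. -/
lemma measurableSet_mem : MeasurableSet {p : Config X × X | p.2 ∈ p.1.carrier} := by
  classical
  have h : Measurable fun p : Config X × X => ∫⁻ y, (if y = p.2 then 1 else 0) ∂p.1.toMeasure :=
    measurable_lintegral_toMeasure measurable_fst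
      (Measurable.ite (measurableSet_eq_fun measurable_snd (measurable_snd.comp measurable_fst))
        measurable_const measurable_const)
  convert h (measurableSet_singleton (0 : ℝ≥0∞)).compl using 1
  ext ⟨ω, x⟩
  simp [lintegral_toMeasure]

lemma toMeasure_eq_of_notMem {ω ω' : Config X} {x : X} (hx : x ∉ ω.carrier)
    (h : ω'.carrier = ω.carrier ∪ {x}) : ω'.toMeasure = ω.toMeasure + Measure.dirac x := by
  ext B hB
  rw [Measure.add_apply, toMeasure_apply _ hB, toMeasure_apply _ hB, Measure.dirac_apply' _ hB, h]
  by_cases hxB : x ∈ B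
  · have : (ω.carrier ∪ {x}) ∩ B = insert x (ω.carrier ∩ B) := by
      ext y; by_cases hy : y = x <;> simp_all
    rw [this, Set.encard_insert_of_notMem (fun h => hx h.1)]
    simp [hxB]
  · have : (ω.carrier ∪ {x}) ∩ B = ω.carrier ∩ B := by
      ext y; by_cases hy : y = x <;> simp_all
    rw [this]
    simp [hxB]

lemma add_eq_self {ω : Config X} {x : X} (hx : x ∈ ω.carrier) : ω.add x = ω := by
  ext y; simp [hx]

lemma measurable_add : Measurable fun p : Config X × X => p.1.add p.2 := by
  classical
  refine measurable_of_toMeasure ?_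
  have : (fun p : Config X × X => (p.1.add p.2).toMeasure) = fun p =>
      if p.2 ∈ p.1.carrier then p.1.toMeasure else p.1.toMeasure + Measure.dirac p.2 := by
    ext1 ⟨ω, x⟩
    dsimp only
    split_ifs with h
    · rw [add_eq_self h]
    · exact toMeasure_eq_of_notMem h rfl
  rw [this]
  have h1 : Measurable fun p : Config X × X => p.1.toMeasure :=
    measurable_toMeasure.comp measurable_fst
  refine Measurable.ite measurableSet_mem h1 ?_
  refine Measure.measurable_of_measurable_coe _ fun s hs => ?_
  simp only [Measure.coe_add, Pi.add_apply]
  exact ((Measure.measurable_coe hs).comp h1).add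
    ((Measure.measurable_coe hs).comp (Measure.measurable_dirac.comp measurable_snd))

lemma measurable_addRange {ι : Type*} [Finite ι] :
    Measurable fun p : Config X × (ι → X) => p.1.addRange p.2 := by
  classical
  have := Fintype.ofFinite ι
  have key : ∀ s : Finset ι, Measurable fun p : Config X × (ι → X) =>
      p.1.addFinset (s.image p.2) := by
    intro s
    induction s using Finset.induction_on with
    | empty =>
      convert (measurable_fst : Measurable fun p : Config X × (ι → X) => p.1) using 2 with p
      ext y; simp
    | insert i s hi ih =>
      convert measurable_add.comp (ih.prodMk ((measurable_pi_apply i).comp measurable_snd))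
        using 2 with p
      ext y
      simp only [carrier_addFinset, Finset.coe_image, Set.mem_union, Set.mem_image, Finset.mem_coe,
        Finset.mem_insert, Function.comp, carrier_add, Set.mem_singleton_iff]
      grind
  convert key Finset.univ using 2 with p
  ext y
  simp

end Measurability

/-! ### Product integrals and inclusion-exclusion -/

section ProductIntegral

lemma lintegral_fin_prod_eq_pow {X : Type*} [MeasurableSpace X] (σ : Measure X) [SigmaFinite σ]
    {g : X → ℝ≥0∞} (hg : Measurable g) (n : ℕ) :
    ∫⁻ x, ∏ i, g (x i) ∂(Measure.pi fun _ : Fin n => σ) = (∫⁻ x, g x ∂σ) ^ n := by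
  induction n with
  | zero => simp
  | succ n ih =>
    have hm : Measurable fun p : X × (Fin n → X) => g p.1 * ∏ i, g (p.2 i) := by fun_prop
    have h := (measurePreserving_piFinSuccAbove (fun _ : Fin (n + 1) => σ) 0).lintegral_comp hm
    simp only [MeasurableEquiv.piFinSuccAbove_apply, Fin.insertNthEquiv_symm_apply] at h
    simp only [Fin.prod_univ_succ]
    rw [pow_succ', ← ih, ← lintegral_prod_mul hg.aemeasurable
      (Measurable.aemeasurable (by fun_prop))]
    exact h

lemma lintegral_fintype_prod_eq_pow {X : Type*} [MeasurableSpace X] (σ : Measure X) [SigmaFinite σ]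
    {g : X → ℝ≥0∞} (hg : Measurable g) (ι : Type*) [Fintype ι] :
    ∫⁻ x, ∏ i, g (x i) ∂(Measure.pi fun _ : ι => σ) = (∫⁻ x, g x ∂σ) ^ Fintype.card ι := by
  let e := (Fintype.equivFin ι).symm
  have hm : Measurable fun x : ι → X => ∏ i, g (x i) := by fun_prop
  rw [← lintegral_fin_prod_eq_pow σ hg,
    ← (measurePreserving_piCongrLeft (fun _ : ι => σ) e).lintegral_comp hm]
  congr 1 with x
  rw [← e.prod_comp]
  simp [MeasurableEquiv.coe_piCongrLeft, Equiv.piCongrLeft_apply_apply]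

variable {ι : Type*} [Fintype ι] [DecidableEq ι]

/-- Inclusion-exclusion over the subsets of `ι` for families agreeing at one index. -/
lemma sum_even_prod_ite_eq_sum_odd {R : Type*} [CommSemiring R] (a b : ι → R) (i₀ : ι)
    (h : a i₀ = b i₀) :
    ∑ S : Finset ι with Even S.card, ∏ i, (if i ∈ S then a i else b i) =
      ∑ S : Finset ι with ¬ Even S.card, ∏ i, (if i ∈ S then a i else b i) := by
  -- Toggling `i₀` flips the parity of S and keeps the product. The even = odd form stands in for a
  -- signed sum, as a semiring has no subtraction.
  have hinv : ∀ S : Finset ι, symmDiff (symmDiff S {i₀}) {i₀} = S := fun S => by simp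
  have hcard : ∀ S : Finset ι, Even (symmDiff S {i₀}).card ↔ ¬ Even S.card := fun S => by
    by_cases hi : i₀ ∈ S
    · have : symmDiff S {i₀} = S.erase i₀ := by
        ext j; by_cases hj : j = i₀ <;> simp [Finset.mem_symmDiff, hj, hi]
      rw [this, ← Finset.card_erase_add_one hi, Nat.even_add_one, not_not]
    · have : symmDiff S {i₀} = insert i₀ S := by
        ext j; by_cases hj : j = i₀ <;> simp [Finset.mem_symmDiff, hj, hi]
      rw [this, Finset.card_insert_of_notMem hi, Nat.even_add_one]
  refine Finset.sum_nbij' (fun S => symmDiff S {i₀}) (fun S => symmDiff S {i₀}) ?_ ?_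
    (fun S _ => hinv S) (fun S _ => hinv S) ?_
  · intro S hS
    rw [Finset.mem_filter_univ] at hS ⊢
    rwa [hcard, not_not]
  · intro S hS
    rw [Finset.mem_filter_univ] at hS ⊢
    rwa [hcard]
  · intro S _
    refine Finset.prod_congr rfl fun i _ => ?_
    by_cases hi : i = i₀
    · subst hi
      simp [h]
    · simp [Finset.mem_symmDiff, hi]

end ProductIntegral

/-! ### The n-point integral under the cyclic condition -/

section Invariance

variable {X Y : Type*} [MetricSpace X] [SigmaCompactSpace X] [MeasurableSpace X] [BorelSpace X]
  [MeasurableSpace Y]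

lemma addRange_addRange_subtype {ι : Type*} [Finite ι] (ω : Config X) (x : ι → X) (p : ι → Prop) :
    (ω.addRange fun i : {i // p i} => x i).addRange (fun i : {i // ¬ p i} => x i) =
      ω.addRange x := by
  ext y
  simp only [carrier_addRange, Set.mem_union, Set.mem_range, Subtype.exists]
  constructor
  · rintro ((h | ⟨i, _, h⟩) | ⟨i, _, h⟩)
    exacts [.inl h, .inr ⟨i, h⟩, .inr ⟨i, h⟩]
  · rintro (h | ⟨i, h⟩)
    · exact .inl (.inl h)
    · by_cases hi : p i
      exacts [.inl (.inr ⟨i, hi, h⟩), .inr ⟨i, hi, h⟩]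

lemma measurable_shift {τ : Config X → X → Y} (hτ : Measurable (Function.uncurry τ))
    {f : Y → ℝ≥0∞} (hf : Measurable f) {ι : Type*} [Finite ι] {α : Type*} [MeasurableSpace α]
    {g : α → Config X} (hg : Measurable g) {x : α → ι → X} (hx : Measurable x) (i : ι) :
    Measurable fun a => f (τ ((g a).addRange (x a)) (x a i)) :=
  hf.comp (hτ.comp ((measurable_addRange.comp (hg.prodMk hx)).prodMk
    ((measurable_pi_apply i).comp hx)))

/-- Adding `n` points and moving them all yields `n` independent points with intensity `μ`. -/
theorem CyclicCondition.lintegral_prod_addRange {τ : Config X → X → Y}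
    (hcyc : CyclicCondition τ) (hτ : Measurable (Function.uncurry τ))
    {σ : Measure X} [SigmaFinite σ] {μ : Measure Y} (hpush : ∀ ω, σ.map (τ ω) = μ)
    {f : Y → ℝ≥0∞} (hf : Measurable f) (hfin : ∫⁻ y, f y ∂μ ≠ ∞)
    {ι : Type*} [Fintype ι] (ω : Config X) :
    ∫⁻ x, ∏ i, f (τ (ω.addRange x) (x i)) ∂(Measure.pi fun _ : ι => σ) =
      (∫⁻ y, f y ∂μ) ^ Fintype.card ι := by
  classical
  induction h : Fintype.card ι using Nat.strong_induction_on generalizing ι ω with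
  | _ n ih =>
  have hτω : ∀ ω, Measurable (τ ω) := fun ω => hτ.comp measurable_prodMk_left
  have hone : ∀ ω, ∫⁻ x, f (τ ω x) ∂σ = ∫⁻ y, f y ∂μ := fun ω => by
    rw [← hpush ω, lintegral_map hf (hτω ω)]
  rcases isEmpty_or_nonempty ι with hι | hι
  · simp [← h]
  set m := ∫⁻ y, f y ∂μ with hm
  have hmn : m ^ n ≠ ∞ := ENNReal.pow_ne_top hfin
  -- The factors in S are frozen at ω, the others see all added points; `T ∅` is the integrand.
  let T : Finset ι → (ι → X) → ℝ≥0∞ := fun S x =>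
    ∏ i, (if i ∈ S then f (τ ω (x i)) else f (τ (ω.addRange x) (x i)))
  have hTm : ∀ S, Measurable (T S) := fun S => Finset.measurable_fun_prod _ fun i _ => by
    split_ifs
    · exact hf.comp ((hτω ω).comp (measurable_pi_apply i))
    · exact measurable_shift hτ hf measurable_const measurable_id i
  have hT : ∀ S : Finset ι, S.Nonempty → ∫⁻ x, T S x ∂(Measure.pi fun _ : ι => σ) = m ^ n := by
    intro S hS
    obtain ⟨p, hp⟩ : ∃ p : ι → Prop, ∀ i, p i ↔ i ∈ S := ⟨(· ∈ S), fun _ => Iff.rfl⟩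
    let G : ({i // p i} → X) × ({i // ¬ p i} → X) → ℝ≥0∞ := fun q =>
      (∏ i, f (τ ω (q.1 i))) * ∏ i, f (τ ((ω.addRange q.1).addRange q.2) (q.2 i))
    have hGm : Measurable G := by
      refine Measurable.mul ?_ ?_
      · exact Finset.measurable_fun_prod _ fun i _ =>
          hf.comp ((hτω ω).comp ((measurable_pi_apply i).comp measurable_fst))
      · exact Finset.measurable_fun_prod _ fun i _ => measurable_shift hτ hf
          (measurable_addRange.comp (measurable_const.prodMk measurable_fst)) measurable_snd i
    have hTG : T S = fun x => G (MeasurableEquiv.piEquivPiSubtypeProd (fun _ => X) p x) := by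
      ext x
      simp only [T, G]
      rw [← Fintype.prod_subtype_mul_prod_subtype p]
      congr 1
      · exact Finset.prod_congr (by ext; simp) fun i _ => by rw [if_pos ((hp i).1 i.2)]; rfl
      · refine Finset.prod_congr rfl fun i _ => ?_
        rw [if_neg (mt (hp i).2 i.2)]
        congr 2
        exact (addRange_addRange_subtype ω x p).symm
    rw [hTG, (measurePreserving_piEquivPiSubtypeProd (fun _ : ι => σ) p).lintegral_comp hGm,
      lintegral_prod _ hGm.aemeasurable]
    have hcard : Fintype.card {i // ¬ p i} < n := by
      rw [← h]
      obtain ⟨i, hi⟩ := hS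
      exact Fintype.card_subtype_lt (x := i) (by simpa [hp] using hi)
    simp only [G]
    -- With the frozen coordinates y fixed, the remaining ones pose the same problem over the
    -- configuration ω ∪ y with fewer points.
    have : ∀ y : {i // p i} → X, ∫⁻ z, (∏ i, f (τ ω (y i))) *
        ∏ i, f (τ ((ω.addRange y).addRange z) (z i)) ∂(Measure.pi fun _ : {i // ¬ p i} => σ) =
        (∏ i, f (τ ω (y i))) * m ^ Fintype.card {i // ¬ p i} := fun y => by
      rw [lintegral_const_mul, ih _ hcard (ω.addRange y) rfl]
      exact Finset.measurable_fun_prod _ fun i _ =>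
        measurable_shift hτ hf measurable_const measurable_id i
    simp only [this]
    rw [lintegral_mul_const, lintegral_fintype_prod_eq_pow σ (g := fun x => f (τ ω x))
      (hf.comp (hτω ω))]
    · simp only [hone]
      rw [← pow_add]
      congr 1
      rw [← h, Fintype.card_subtype_compl,
        Nat.add_sub_cancel' (Fintype.card_subtype_le p)]
    · exact Finset.measurable_fun_prod _ fun i _ =>
          hf.comp ((hτω ω).comp (measurable_pi_apply i))
  have hpt : ∀ x, ∑ S : Finset ι with Even S.card, T S x =
      ∑ S : Finset ι with ¬ Even S.card, T S x := fun x => by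
    obtain ⟨i₀, hi₀⟩ := hcyc.exists_addRange_eq ω x
    exact sum_even_prod_ite_eq_sum_odd _ _ i₀ (by rw [hi₀])
  have hint : ∑ S : Finset ι with Even S.card, ∫⁻ x, T S x ∂(Measure.pi fun _ : ι => σ) =
      ∑ S : Finset ι with ¬ Even S.card, ∫⁻ x, T S x ∂(Measure.pi fun _ : ι => σ) := by
    rw [← lintegral_finsetSum _ fun S _ => hTm S, ← lintegral_finsetSum _ fun S _ => hTm S]
    exact lintegral_congr hpt
  have hcount : ∑ S : Finset ι with Even S.card, m ^ n =
      ∑ S : Finset ι with ¬ Even S.card, m ^ n := by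
    have := sum_even_prod_ite_eq_sum_odd (ι := ι) (fun _ => (1 : ℕ)) (fun _ => 1) hι.some rfl
    simp only [ite_self, Finset.prod_const_one, Finset.sum_const, smul_eq_mul, mul_one] at this
    simp only [Finset.sum_const, this]
  have hmem : (∅ : Finset ι) ∈ ({S | Even S.card} : Finset (Finset ι)) := by simp
  rw [← Finset.add_sum_erase _ _ hmem] at hint hcount
  have h1 : ∑ S ∈ ({S | Even S.card} : Finset (Finset ι)).erase ∅,
      ∫⁻ x, T S x ∂(Measure.pi fun _ : ι => σ) =
      ∑ S ∈ ({S | Even S.card} : Finset (Finset ι)).erase ∅, m ^ n :=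
    Finset.sum_congr rfl fun S hS => hT S (Finset.nonempty_iff_ne_empty.2 (Finset.ne_of_mem_erase hS))
  have h2 : ∑ S : Finset ι with ¬ Even S.card, ∫⁻ x, T S x ∂(Measure.pi fun _ : ι => σ) =
      ∑ S : Finset ι with ¬ Even S.card, m ^ n := by
    refine Finset.sum_congr rfl fun S hS => hT S ?_
    rw [Finset.nonempty_iff_ne_empty]
    rintro rfl
    simp at hS
  rw [h1, h2, ← hcount] at hint
  -- All terms but `S = ∅` are `m ^ n` and equally many subsets are even and odd, so the common
  -- finite sum cancels.
  have h3 := (ENNReal.add_left_inj (ENNReal.sum_ne_top.2 fun _ _ => hmn)).1 hint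
  rw [← h3]
  simp [T]

end Invariance

/-! ### Probability generating functions -/

section GeneratingFunction

open BoundedContinuousFunction

/-- Finite measures on `ι → ℕ` are determined by their probability generating functions. -/
theorem ext_of_integral_prod_pow {ι : Type*} [Fintype ι] {P P' : Measure (ι → ℕ)}
    [IsFiniteMeasure P] [IsFiniteMeasure P']
    (h : ∀ z : ι → ℝ, (∀ i, z i ∈ Set.Icc (0 : ℝ) 1) →
      ∫ n, ∏ i, z i ^ n i ∂P = ∫ n, ∏ i, z i ^ n i ∂P') : P = P' := by
  classical
  -- Monomials are closed under products, so the algebra they generate is their linear span and the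
  -- hypothesis extends to it by linearity.
  let M : Submonoid ((ι → ℕ) →ᵇ ℝ) :=
    { carrier := {g | ∃ z : ι → ℝ, (∀ i, z i ∈ Set.Icc (0 : ℝ) 1) ∧ ∀ n, g n = ∏ i, z i ^ n i}
      mul_mem' := by
        rintro f g ⟨z, hz, hf⟩ ⟨w, hw, hg⟩
        refine ⟨fun i => z i * w i, fun i => ⟨mul_nonneg (hz i).1 (hw i).1,
          mul_le_one₀ (hz i).2 (hw i).1 (hw i).2⟩, fun n => ?_⟩
        simp [hf, hg, mul_pow, Finset.prod_mul_distrib]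
      one_mem' := ⟨fun _ => 1, fun _ => by simp, fun n => by simp⟩ }
  let A : StarSubalgebra ℝ ((ι → ℕ) →ᵇ ℝ) :=
    { Algebra.adjoin ℝ (M : Set ((ι → ℕ) →ᵇ ℝ)) with
      star_mem' := by
        intro a ha
        have : star a = a := by ext; simp
        rwa [this] }
  have hA : ∀ g, g ∈ A ↔ g ∈ Submodule.span ℝ (M : Set ((ι → ℕ) →ᵇ ℝ)) := by
    intro g
    have : g ∈ A ↔ g ∈ Subalgebra.toSubmodule (Algebra.adjoin ℝ (M : Set ((ι → ℕ) →ᵇ ℝ))) :=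
      Iff.rfl
    rw [this, Algebra.adjoin_eq_span, Submonoid.closure_eq]
  refine ext_of_forall_mem_subalgebra_integral_eq_of_polish (A := A) ?_ ?_
  · intro n n' hn
    obtain ⟨i, hi⟩ : ∃ i, n i ≠ n' i := Function.ne_iff.1 hn
    -- This monomial is `(1 / 2) ^ n i`, injective in `n i`, so the algebra separates points.
    let z : ι → ℝ := Function.update (fun _ => 1) i (1 / 2)
    have hz : ∀ j, z j ∈ Set.Icc (0 : ℝ) 1 := fun j => by
      by_cases hj : j = i
      · subst hj; simp [z]; norm_num
      · simp [z, hj]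
    have hprod : ∀ n : ι → ℕ, ∏ j, z j ^ n j = (1 / 2) ^ n i := fun n => by
      rw [Finset.prod_eq_single i]
      · simp [z]
      · intro j _ hj; simp [z, hj]
      · simp
    let g : (ι → ℕ) →ᵇ ℝ := BoundedContinuousFunction.ofNormedAddCommGroup
      (fun n => ∏ j, z j ^ n j) continuous_of_discreteTopology 1 (fun n => by
        rw [hprod, norm_pow]
        exact pow_le_one₀ (norm_nonneg _) (by norm_num))
    have hg : g ∈ A := (hA g).2 (Submodule.subset_span ⟨z, hz, fun n => rfl⟩)
    refine ⟨g, ⟨toContinuousMapStarₐ ℝ g, ⟨g, hg, rfl⟩, rfl⟩, ?_⟩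
    change ∏ j, z j ^ n j ≠ ∏ j, z j ^ n' j
    rw [hprod, hprod]
    exact fun h => hi (pow_right_injective₀ (by norm_num) (by norm_num) h)
  · intro g hg
    rw [hA] at hg
    induction hg using Submodule.span_induction with
    | mem g hg =>
      obtain ⟨z, hz, hg⟩ := hg
      simp only [hg]
      exact h z hz
    | zero => simp
    | add f g _ _ hf hg =>
      simp only [coe_add, Pi.add_apply]
      rw [integral_add (f.integrable _) (g.integrable _),
        integral_add (f.integrable _) (g.integrable _), hf, hg]
    | smul c g _ hg =>
      simp only [coe_smul]
      rw [integral_smul, integral_smul, hg]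

end GeneratingFunction

/-! ### Generating functionals of point processes -/

section Functional

variable {X : Type*} [MetricSpace X] [MeasurableSpace X] [BorelSpace X]

/-- The product of the values of `h` over the points of `ω`. -/
noncomputable def gen (h : X → ℝ) (ω : Config X) : ℝ := ∏ᶠ x ∈ ω.carrier, h x

/-- Finitely valued measurable test functions with values in `[0, 1]` that are equal to `1` off a
compact set. -/
structure IsTest (h : X → ℝ) : Prop where
  measurable : Measurable h
  finite_range : (Set.range h).Finite
  mem_Icc : ∀ x, h x ∈ Set.Icc (0 : ℝ) 1
  bdd : Bdd {x | h x ≠ 1}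

lemma gen_eq_prod {h : X → ℝ} {ω : Config X} {S : Finset X} (hS : ∀ x ∈ S, x ∈ ω.carrier)
    (hS' : ∀ x ∈ ω.carrier, h x ≠ 1 → x ∈ S) : gen h ω = ∏ x ∈ S, h x := by
  rw [gen, finprod_mem_eq_prod_of_inter_mulSupport_eq]
  ext x
  simp only [Set.mem_inter_iff, Function.mem_mulSupport, Finset.mem_coe]
  exact ⟨fun h => ⟨hS' x h.1 h.2, h.2⟩, fun h => ⟨hS x h.1, h.2⟩⟩

lemma Bdd.exists_finset {B : Set X} (hB : Bdd B) (ω : Config X) :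
    ∃ S : Finset X, ∀ x, x ∈ S ↔ x ∈ ω.carrier ∧ x ∈ B :=
  ⟨(hB.finite_inter ω).toFinset, by simp⟩

open Classical in
lemma count_eq_card_filter {B C : Set X} (hC : C ⊆ B) {ω : Config X} {S : Finset X}
    (hS : ∀ x, x ∈ S ↔ x ∈ ω.carrier ∧ x ∈ B) : count C ω = (S.filter (· ∈ C)).card := by
  rw [count, ← Set.ncard_coe_finset]
  congr 1
  ext x
  simp only [Set.mem_inter_iff, Finset.coe_filter, hS, Set.mem_ofPred_eq]
  exact ⟨fun h => ⟨⟨h.1, hC h.2⟩, h.2⟩, fun h => ⟨h.1.1, h.2⟩⟩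

/-- Points are grouped by the value of h. The value 1 is left out: it contributes nothing, and its
level set may contain infinitely many points. -/
lemma IsTest.gen_eq_prod_pow {h : X → ℝ} (hh : IsTest h) (ω : Config X) :
    gen h ω = ∏ v ∈ hh.finite_range.toFinset.erase 1, v ^ count (h ⁻¹' {v}) ω := by
  classical
  obtain ⟨S, hS⟩ := hh.bdd.exists_finset ω
  rw [gen_eq_prod (S := S) (fun x hx => ((hS x).1 hx).1) (fun x hx h1 => (hS x).2 ⟨hx, h1⟩),
    ← Finset.prod_fiberwise_of_maps_to (g := h) (t := hh.finite_range.toFinset.erase 1)]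
  · refine Finset.prod_congr rfl fun v hv => ?_
    rw [Finset.prod_congr rfl (g := fun _ => v), Finset.prod_const]
    · rw [count_eq_card_filter _ hS]
      · simp
      · rintro x rfl
        simp at hv
        simpa using hv
    · intro x hx
      exact (Finset.mem_filter.1 hx).2
  · intro x hx
    simpa using ((hS x).1 hx).2

lemma IsTest.bdd_preimage {h : X → ℝ} (hh : IsTest h) {v : ℝ} (hv : v ≠ 1) : Bdd (h ⁻¹' {v}) :=
  hh.bdd.mono (hh.measurable (measurableSet_singleton v)) (by rintro x rfl; exact hv)

lemma IsTest.gen_mem_Icc {h : X → ℝ} (hh : IsTest h) (ω : Config X) :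
    gen h ω ∈ Set.Icc (0 : ℝ) 1 := by
  obtain ⟨S, hS⟩ := hh.bdd.exists_finset ω
  rw [gen_eq_prod (S := S) (fun x hx => ((hS x).1 hx).1) (fun x hx h1 => (hS x).2 ⟨hx, h1⟩)]
  exact ⟨Finset.prod_nonneg fun x _ => (hh.mem_Icc x).1,
    Finset.prod_le_one (fun x _ => (hh.mem_Icc x).1) fun x _ => (hh.mem_Icc x).2⟩

lemma IsTest.measurable_gen {h : X → ℝ} (hh : IsTest h) : Measurable (gen h) := by
  have : gen h = fun ω => ∏ v ∈ hh.finite_range.toFinset.erase 1, v ^ count (h ⁻¹' {v}) ω :=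
    funext hh.gen_eq_prod_pow
  rw [this]
  exact Finset.measurable_fun_prod _ fun v hv =>
    measurable_const.pow (hh.bdd_preimage (Finset.ne_of_mem_erase hv)).measurable_count

lemma IsTest.integrable_gen {h : X → ℝ} (hh : IsTest h) (Q : Measure (Config X))
    [IsFiniteMeasure Q] : Integrable (gen h) Q :=
  Integrable.of_bound hh.measurable_gen.aestronglyMeasurable 1 (.of_forall fun ω => by
    rw [Real.norm_eq_abs, abs_of_nonneg (hh.gen_mem_Icc ω).1]
    exact (hh.gen_mem_Icc ω).2)

section Family

variable {ι : Type*} [Fintype ι] {B : ι → Set X} {z : ι → ℝ}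

open Classical in
/-- The test function attached to the monomial `∏ i, z i ^ ω(B i)`. -/
noncomputable def monomialTest (B : ι → Set X) (z : ι → ℝ) (x : X) : ℝ :=
  ∏ i, if x ∈ B i then z i else 1

lemma isTest_monomialTest (hB : ∀ i, Bdd (B i)) (hz : ∀ i, z i ∈ Set.Icc (0 : ℝ) 1) :
    IsTest (monomialTest B z) where
  measurable := Finset.measurable_fun_prod _ fun i _ =>
    Measurable.ite (hB i).1 measurable_const measurable_const
  finite_range := by
    classical
    refine (Set.finite_range fun s : Finset ι => ∏ i, if i ∈ s then z i else 1).subset ?_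
    rintro _ ⟨x, rfl⟩
    exact ⟨Finset.univ.filter (x ∈ B ·), by simp [monomialTest]⟩
  mem_Icc := fun x => by
    classical
    have h0 : ∀ i, (if x ∈ B i then z i else 1) ∈ Set.Icc (0 : ℝ) 1 := fun i => by
      split_ifs
      · exact hz i
      · simp
    exact ⟨Finset.prod_nonneg fun i _ => (h0 i).1,
      Finset.prod_le_one (fun i _ => (h0 i).1) fun i _ => (h0 i).2⟩
  bdd := by
    classical
    choose K hK hBK using fun i => (hB i).2
    refine ⟨?_, ⋃ i, K i, isCompact_iUnion hK, ?_⟩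
    · exact (Finset.measurable_fun_prod _ fun i _ =>
        Measurable.ite (hB i).1 measurable_const measurable_const :
        Measurable (monomialTest B z)) (measurableSet_singleton 1).compl
    · intro x hx
      by_contra hcon
      refine hx (Finset.prod_eq_one fun i _ => if_neg fun hxi => hcon ?_)
      exact Set.mem_iUnion.2 ⟨i, hBK i hxi⟩

lemma gen_monomialTest (hB : ∀ i, Bdd (B i)) (ω : Config X) :
    gen (monomialTest B z) ω = ∏ i, z i ^ count (B i) ω := by
  classical
  choose K hK hBK using fun i => (hB i).2
  obtain ⟨S, hS⟩ := (Bdd.of_isCompact (isCompact_iUnion hK)).exists_finset ω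
  rw [gen_eq_prod (S := S) (fun x hx => ((hS x).1 hx).1)]
  · simp only [monomialTest]
    rw [Finset.prod_comm]
    refine Finset.prod_congr rfl fun i _ => ?_
    rw [count_eq_card_filter ((hBK i).trans (Set.subset_iUnion K i)) hS]
    simp [Finset.prod_ite]
  · intro x hx h1
    by_contra hcon
    refine h1 (Finset.prod_eq_one fun i _ => if_neg fun hxi => hcon ?_)
    exact (hS x).2 ⟨hx, Set.mem_iUnion.2 ⟨i, hBK i hxi⟩⟩

end Family

variable [SigmaCompactSpace X]

/-- Cutting a Borel set along the pieces writes its mass as a series of finite counts, so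
natural-number coordinates suffice and measures can be compared through finite-dimensional laws. -/
lemma measurableSpace_eq_comap_count :
    (instMeasurableSpace : MeasurableSpace (Config X)) =
      MeasurableSpace.comap (fun ω (B : {B : Set X // Bdd B}) => count B.1 ω) inferInstance := by
  apply le_antisymm
  · let m : MeasurableSpace (Config X) :=
      MeasurableSpace.comap (fun ω (B : {B : Set X // Bdd B}) => count B.1 ω) inferInstance
    have h : Measurable[m] (toMeasure : Config X → Measure X) := by
      refine @Measure.measurable_of_measurable_coe _ _ _ m _ fun s hs => ?_
      have : (fun ω : Config X => ω.toMeasure s) = fun ω =>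
          ∑' n, (count (s ∩ piece X n) ω : ℝ≥0∞) := by
        ext ω
        rw [← sum_restrict_piece ω.toMeasure, Measure.sum_apply _ hs]
        refine tsum_congr fun n => ?_
        rw [Measure.restrict_apply hs, Bdd.toMeasure_apply]
        exact (bdd_piece n).mono (hs.inter (bdd_piece n).1) Set.inter_subset_right
      rw [this]
      refine Measurable.tsum fun n => ?_
      have hb : Bdd (s ∩ piece X n) :=
        (bdd_piece n).mono (hs.inter (bdd_piece n).1) Set.inter_subset_right
      have h1 : Measurable[m] fun ω (B : {B : Set X // Bdd B}) => count B.1 ω :=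
        comap_measurable _
      exact (measurable_of_countable (fun k : ℕ => (k : ℝ≥0∞))).comp
        ((measurable_pi_apply (⟨_, hb⟩ : {B : Set X // Bdd B})).comp h1)
    exact measurable_iff_comap_le.1 h
  · exact measurable_iff_comap_le.1 (measurable_pi_lambda _ fun B => B.2.measurable_count)

/-- Finite measures on the configuration space are determined by their generating functionals. -/
theorem ext_of_integral_gen {Q₁ Q₂ : Measure (Config X)} [IsFiniteMeasure Q₁] [IsFiniteMeasure Q₂]
    (h : ∀ f : X → ℝ, IsTest f → ∫ ω, gen f ω ∂Q₁ = ∫ ω, gen f ω ∂Q₂) : Q₁ = Q₂ := by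
  let Φ : Config X → {B : Set X // Bdd B} → ℕ := fun ω B => count B.1 ω
  have hΦ : Measurable Φ := measurable_pi_lambda _ fun B => B.2.measurable_count
  have key : ∀ I : Finset {B : Set X // Bdd B},
      (Q₁.map Φ).map I.restrict = (Q₂.map Φ).map I.restrict := by
    intro I
    have hI : Measurable (I.restrict (π := fun _ : {B : Set X // Bdd B} => ℕ)) :=
      Finset.measurable_restrict I
    refine ext_of_integral_prod_pow fun z hz => ?_
    have hm : Measurable fun n : I → ℕ => ∏ i, z i ^ n i := measurable_of_countable _
    rw [Measure.map_map hI hΦ, Measure.map_map hI hΦ,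
      integral_map (hI.comp hΦ).aemeasurable hm.aestronglyMeasurable,
      integral_map (hI.comp hΦ).aemeasurable hm.aestronglyMeasurable]
    have := h _ (isTest_monomialTest (B := fun i : I => i.1.1) (fun i => i.1.2) hz)
    simp only [gen_monomialTest (B := fun i : I => i.1.1) (fun i => i.1.2)] at this
    exact this
  -- Both laws of the family of counts are projective limits of the same finite-dimensional
  -- marginals.
  have hmap : Q₁.map Φ = Q₂.map Φ :=
    IsProjectiveLimit.unique (P := fun I => (Q₁.map Φ).map I.restrict) (fun I => rfl)
      (fun I => (key I).symm)
  refine Measure.ext fun s hs => ?_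
  rw [measurableSpace_eq_comap_count] at hs
  obtain ⟨t, ht, rfl⟩ := hs
  have := congrArg (fun Q => Q t) hmap
  simpa only [Measure.map_apply hΦ ht] using this

end Functional

/-! ### Differentiating generating functions at 1 -/

section RealAnalysis

open Filter Topology

lemma integral_pow_poissonMeasure (r : ℝ≥0) (z : ℝ) :
    ∫ n, z ^ n ∂poissonMeasure r = Real.exp (-((1 - z) * r)) := by
  rw [integral_poissonMeasure]
  have h : (fun n : ℕ => (Real.exp (-(r : ℝ)) * (r : ℝ) ^ n / (n.factorial : ℝ)) • z ^ n) =
      fun n => Real.exp (-(r : ℝ)) * ((r * z) ^ n / (n.factorial : ℝ)) := by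
    ext n
    rw [smul_eq_mul, mul_pow]
    ring
  rw [h, tsum_mul_left, (NormedSpace.expSeries_div_hasSum_exp (r * z : ℝ)).tsum_eq,
    ← Real.exp_eq_exp_ℝ, ← Real.exp_add]
  congr 1
  ring

/-- If `E[Z z ^ N] = c exp (-(1 - z) b)` for `z ∈ [0, 1]`, then `E[Z N] = c b`. -/
lemma lintegral_mul_natCast_of_integral_pow {Ω : Type*} [MeasurableSpace Ω] {P : Measure Ω}
    [IsFiniteMeasure P] {N : Ω → ℕ} (hN : Measurable N) {Z : Ω → ℝ} (hZ : Measurable Z)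
    (hZ01 : ∀ ω, Z ω ∈ Set.Icc (0 : ℝ) 1) {b c : ℝ}
    (h : ∀ z ∈ Set.Icc (0 : ℝ) 1, ∫ ω, Z ω * z ^ N ω ∂P = c * Real.exp (-((1 - z) * b))) :
    ∫⁻ ω, ENNReal.ofReal (Z ω) * N ω ∂P = ENNReal.ofReal (c * b) := by
  let r : ℕ → ℝ := fun k => 1 / ((k : ℝ) + 1)
  have hr0 : ∀ k, 0 < r k := fun k => by positivity
  have hr1 : ∀ k, r k ≤ 1 := fun k => by
    simp only [r]
    rw [div_le_one (by positivity)]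
    linarith [(Nat.cast_nonneg k : (0 : ℝ) ≤ k)]
  have hz : ∀ k, 1 - r k ∈ Set.Icc (0 : ℝ) 1 := fun k =>
    ⟨by linarith [hr1 k], by linarith [hr0 k]⟩
  have hrt : Tendsto r atTop (𝓝 0) := tendsto_one_div_add_atTop_nhds_zero_nat
  -- The difference quotient of `z ↦ Z * z ^ N` between `1 - r k` and 1, as a geometric sum. It
  -- increases to `Z * N`, so monotone convergence applies without integrability of N.
  let G : ℕ → Ω → ℝ := fun k ω => Z ω * ∑ j ∈ Finset.range (N ω), (1 - r k) ^ j
  have hG : ∀ k ω, G k ω = (r k)⁻¹ * (Z ω * 1 ^ N ω - Z ω * (1 - r k) ^ N ω) := fun k ω => by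
    have := mul_neg_geom_sum (1 - r k) (N ω)
    simp only [G]
    rw [one_pow, mul_one, ← mul_one_sub, ← this]
    have := (hr0 k).ne'
    field_simp
    ring
  have hGm : ∀ k, Measurable (G k) := fun k => by
    have : G k = fun ω => (r k)⁻¹ * (Z ω * 1 ^ N ω - Z ω * (1 - r k) ^ N ω) := funext (hG k)
    rw [this]
    exact measurable_const.mul ((hZ.mul (measurable_const.pow hN)).sub
      (hZ.mul (measurable_const.pow hN)))
  have hG0 : ∀ k ω, 0 ≤ G k ω := fun k ω =>
    mul_nonneg (hZ01 ω).1 (Finset.sum_nonneg fun j _ => pow_nonneg (hz k).1 j)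
  have hint : ∀ z ∈ Set.Icc (0 : ℝ) 1, Integrable (fun ω => Z ω * z ^ N ω) P := fun z hz =>
    Integrable.of_bound (hZ.mul (measurable_const.pow hN)).aestronglyMeasurable 1
      (.of_forall fun ω => by
        rw [Real.norm_eq_abs, abs_of_nonneg (mul_nonneg (hZ01 ω).1 (pow_nonneg hz.1 _))]
        exact mul_le_one₀ (hZ01 ω).2 (pow_nonneg hz.1 _) (pow_le_one₀ hz.1 hz.2))
  have hGint : ∀ k, ∫⁻ ω, ENNReal.ofReal (G k ω) ∂P =
      ENNReal.ofReal (c * ((r k)⁻¹ * (1 - Real.exp (-(r k * b))))) := fun k => by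
    rw [← ofReal_integral_eq_lintegral_ofReal _ (.of_forall (hG0 k))]
    · congr 1
      simp only [hG]
      rw [integral_const_mul, integral_sub (hint 1 (by simp)) (hint _ (hz k)), h 1 (by simp),
        h _ (hz k)]
      simp
      ring
    · have : G k = fun ω => (r k)⁻¹ * (Z ω * 1 ^ N ω - Z ω * (1 - r k) ^ N ω) := funext (hG k)
      rw [this]
      exact ((hint 1 (by simp)).sub (hint _ (hz k))).const_mul _
  have hlim1 : Tendsto (fun k => ∫⁻ ω, ENNReal.ofReal (G k ω) ∂P) atTop
      (𝓝 (∫⁻ ω, ENNReal.ofReal (Z ω) * N ω ∂P)) := by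
    refine lintegral_tendsto_of_tendsto_of_monotone
      (fun k => (hGm k).ennreal_ofReal.aemeasurable) (.of_forall fun ω => ?_)
      (.of_forall fun ω => ?_)
    · intro k l hkl
      refine ENNReal.ofReal_le_ofReal (mul_le_mul_of_nonneg_left ?_ (hZ01 ω).1)
      refine Finset.sum_le_sum fun j _ => pow_le_pow_left₀ (hz k).1 ?_ j
      have : r l ≤ r k := one_div_le_one_div_of_le (by positivity) (by gcongr)
      linarith
    · have : ENNReal.ofReal (Z ω) * N ω = ENNReal.ofReal (Z ω * N ω) := by
        rw [ENNReal.ofReal_mul (hZ01 ω).1, ENNReal.ofReal_natCast]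
      rw [this]
      refine (ENNReal.continuous_ofReal.tendsto _).comp (Tendsto.const_mul _ ?_)
      have : Tendsto (fun k => ∑ j ∈ Finset.range (N ω), (1 - r k) ^ j) atTop
          (𝓝 (∑ j ∈ Finset.range (N ω), (1 - 0 : ℝ) ^ j)) :=
        tendsto_finsetSum _ fun j _ => (tendsto_const_nhds.sub hrt).pow j
      simpa using this
  -- The limit is the derivative at 0 of `t ↦ -exp(-t b)`.
  have hlim2 : Tendsto (fun k => (r k)⁻¹ * (1 - Real.exp (-(r k * b)))) atTop (𝓝 b) := by
    have hd : HasDerivAt (fun t => -Real.exp (-(t * b))) b 0 := by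
      have h1 : HasDerivAt (fun t : ℝ => -(t * b)) (-(1 * b)) 0 :=
        ((hasDerivAt_id (0 : ℝ)).mul_const b).neg
      exact h1.exp.neg.congr_deriv (by simp)
    have h2 := hd.tendsto_slope_zero
    have hr' : Tendsto r atTop (𝓝[≠] 0) :=
      tendsto_nhdsWithin_iff.2 ⟨hrt, .of_forall fun k => (hr0 k).ne'⟩
    refine (h2.comp hr').congr fun k => ?_
    simp only [Function.comp_apply, zero_add, zero_mul, neg_zero, Real.exp_zero, smul_eq_mul]
    ring
  simp only [hGint] at hlim1
  exact tendsto_nhds_unique hlim1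
    ((ENNReal.continuous_ofReal.tendsto _).comp (hlim2.const_mul c))

lemma lintegral_natCast_poissonMeasure (r : ℝ≥0) :
    ∫⁻ n : ℕ, (n : ℝ≥0∞) ∂poissonMeasure r = r := by
  have := lintegral_mul_natCast_of_integral_pow (P := poissonMeasure r) (N := id) measurable_id
    (Z := fun _ => 1) measurable_const (fun _ => by simp) (b := r) (c := 1) (fun z _ => by
      simpa using integral_pow_poissonMeasure r z)
  simpa using this

end RealAnalysis

/-! ### Intensity and generating functional of a Poisson measure -/

section Intensity

variable {X : Type*} [MetricSpace X] [SigmaCompactSpace X] [MeasurableSpace X] [BorelSpace X]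
  {σ : Measure X} [IsFiniteMeasureOnCompacts σ] {P : Measure (Config X)}

lemma generateFrom_isCompact : ‹MeasurableSpace X› = MeasurableSpace.generateFrom
    {K : Set X | IsCompact K} := by
  apply le_antisymm
  · rw [BorelSpace.measurable_eq (α := X), borel_eq_generateFrom_isClosed]
    refine MeasurableSpace.generateFrom_le fun F hF => ?_
    have : F = ⋃ n, F ∩ compactCovering X n := by
      rw [← Set.inter_iUnion, iUnion_compactCovering, Set.inter_univ]
    rw [this]
    exact MeasurableSet.iUnion fun n => MeasurableSpace.measurableSet_generateFrom
      ((isCompact_compactCovering X n).inter_left hF)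
  · exact MeasurableSpace.generateFrom_le fun K hK => IsCompact.measurableSet hK

lemma isPiSystem_isCompact : IsPiSystem {K : Set X | IsCompact K} :=
  fun _ hK _ hL _ => IsCompact.inter hK hL

/-- The mean measure and σ agree on compact sets, which form a generating π-system exhausting X. -/
lemma IsPoissonMeasure.lintegral_toMeasure_apply (hP : IsPoissonMeasure σ P) {B : Set X}
    (hB : MeasurableSet B) : ∫⁻ ω, ω.toMeasure B ∂P = σ B := by
  have key : σ = P.bind toMeasure := by
    refine Measure.ext_of_generateFrom_of_iUnion _ (compactCovering X) generateFrom_isCompact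
      isPiSystem_isCompact (iUnion_compactCovering X) (isCompact_compactCovering X)
      (fun n => (isCompact_compactCovering X n).measure_ne_top) fun K (hK : IsCompact K) => ?_
    rw [Measure.bind_apply hK.measurableSet measurable_toMeasure.aemeasurable]
    simp only [(Bdd.of_isCompact hK).toMeasure_apply]
    have h := hP.hasLaw_count K hK
    have := lintegral_map' (μ := P) (f := fun n : ℕ => (n : ℝ≥0∞)) (g := count K)
      (measurable_of_countable _).aemeasurable h.aemeasurable
    rw [← this, h.map_eq, lintegral_natCast_poissonMeasure, ENNReal.coe_toNNReal hK.measure_ne_top]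
  conv_rhs => rw [key]
  rw [Measure.bind_apply hB measurable_toMeasure.aemeasurable]

lemma IsPoissonMeasure.integrable_count (hP : IsPoissonMeasure σ P) {B : Set X}
    (hB : Bdd B) : Integrable (fun ω => (count B ω : ℝ)) P := by
  refine ⟨((measurable_of_countable (fun n : ℕ => (n : ℝ))).comp
    hB.measurable_count).aestronglyMeasurable, ?_⟩
  rw [hasFiniteIntegral_iff_ofReal (.of_forall fun _ => Nat.cast_nonneg _)]
  simp only [ENNReal.ofReal_natCast, ← hB.toMeasure_apply]
  rw [hP.lintegral_toMeasure_apply hB.1]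
  exact hB.measure_lt_top σ

lemma IsPoissonMeasure.integral_count (hP : IsPoissonMeasure σ P) {B : Set X}
    (hB : Bdd B) : ∫ ω, (count B ω : ℝ) ∂P = (σ B).toReal := by
  rw [integral_eq_lintegral_of_nonneg_ae (.of_forall fun _ => Nat.cast_nonneg _)
    (hP.integrable_count hB).1]
  simp only [ENNReal.ofReal_natCast, ← hB.toMeasure_apply]
  rw [hP.lintegral_toMeasure_apply hB.1]

lemma IsPoissonMeasure.integral_prod_pow_of_isCompact (hP : IsPoissonMeasure σ P) {ι : Type*}
    [Fintype ι] {A : ι → Set X} (hA : ∀ i, IsCompact (A i))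
    (hd : Pairwise fun i j => Disjoint (A i) (A j)) (z : ι → ℝ) :
    ∫ ω, ∏ i, z i ^ count (A i) ω ∂P = Real.exp (-∑ i, (1 - z i) * (σ (A i)).toReal) := by
  have hprob := hP.isProbabilityMeasure
  let e := Fintype.equivFin ι
  have h1 := (hP.iIndepFun_count (Fintype.card ι) (fun i => A (e.symm i)) (fun i => hA _)
    (fun i j hij => hd (e.symm.injective.ne hij))).precomp (g := e) e.injective
  simp only [Equiv.symm_apply_apply] at h1
  have h2 := h1.comp (fun i (n : ℕ) => z i ^ n) (fun i => measurable_of_countable _)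
  have h3 := h2.integral_fun_prod_eq_prod_integral (fun i =>
    ((measurable_of_countable (fun n : ℕ => z i ^ n)).comp
      (Bdd.of_isCompact (hA i)).measurable_count).aestronglyMeasurable)
  simp only [Function.comp_apply] at h3
  rw [h3, ← Finset.sum_neg_distrib, Real.exp_sum]
  refine Finset.prod_congr rfl fun i _ => ?_
  have h4 := hP.hasLaw_count (A i) (hA i)
  rw [← integral_map (f := fun n : ℕ => z i ^ n) h4.aemeasurable
    (measurable_of_countable _).aestronglyMeasurable, h4.map_eq, integral_pow_poissonMeasure]
  rfl

lemma Bdd.exists_isCompact_sdiff_lt {B : Set X} (hB : Bdd B) (σ : Measure X)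
    [IsFiniteMeasureOnCompacts σ] {ε : ℝ≥0∞} (hε : ε ≠ 0) :
    ∃ K, K ⊆ B ∧ IsCompact K ∧ σ (B \ K) < ε := by
  obtain ⟨hBm, L, hL, hBL⟩ := hB
  have : IsFiniteMeasure (σ.restrict L) := ⟨by simpa using hL.measure_lt_top⟩
  obtain ⟨F, hFB, hF, h⟩ := hBm.exists_isClosed_sdiff_lt (μ := σ.restrict L) (measure_ne_top _ _) hε
  refine ⟨F, hFB, hL.of_isClosed_subset hF (hFB.trans hBL), ?_⟩
  rwa [Measure.restrict_apply (hBm.diff hF.measurableSet), Set.inter_eq_left.2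
    (Set.sdiff_subset.trans hBL)] at h

lemma count_sdiff_add {A B : Set X} (hB : Bdd B) (hAB : A ⊆ B) (ω : Config X) :
    count A ω + count (B \ A) ω = count B ω := by
  rw [count, count, count, ← Set.ncard_union_eq
    ((Set.disjoint_sdiff_right).mono Set.inter_subset_right Set.inter_subset_right)
    ((hB.finite_inter ω).subset (Set.inter_subset_inter_right _ hAB))
    ((hB.finite_inter ω).subset (Set.inter_subset_inter_right _ Set.sdiff_subset)),
    ← Set.inter_union_distrib_left, Set.union_sdiff_cancel hAB]

open Filter Topology in
-- The definition only speaks of compact sets, while level sets of test functions are merely Borel.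
-- Inner approximation by compacts bridges the gap: the error is at most the mean number of points
-- in the differences.
lemma IsPoissonMeasure.integral_prod_pow (hP : IsPoissonMeasure σ P) {ι : Type*}
    [Fintype ι] {B : ι → Set X} (hB : ∀ i, Bdd (B i))
    (hd : Pairwise fun i j => Disjoint (B i) (B j)) {z : ι → ℝ}
    (hz : ∀ i, z i ∈ Set.Icc (0 : ℝ) 1) :
    ∫ ω, ∏ i, z i ^ count (B i) ω ∂P = Real.exp (-∑ i, (1 - z i) * (σ (B i)).toReal) := by
  have hprob := hP.isProbabilityMeasure
  have hε : ∀ n : ℕ, ENNReal.ofReal (1 / ((n : ℝ) + 1)) ≠ 0 := fun n => by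
    simp only [ne_eq, ENNReal.ofReal_eq_zero, not_le]
    positivity
  choose K hKB hK hKσ using fun (n : ℕ) (i : ι) => (hB i).exists_isCompact_sdiff_lt σ (hε n)
  have hKb : ∀ n i, Bdd (K n i) := fun n i => Bdd.of_isCompact (hK n i)
  have hdb : ∀ n i, Bdd (B i \ K n i) := fun n i =>
    (hB i).mono ((hB i).1.diff (hK n i).measurableSet) Set.sdiff_subset
  have hdσ : ∀ i, Tendsto (fun n => (σ (B i \ K n i)).toReal) atTop (𝓝 0) := fun i => by
    refine squeeze_zero (fun _ => ENNReal.toReal_nonneg) (fun n => ?_)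
      tendsto_one_div_add_atTop_nhds_zero_nat
    exact ENNReal.toReal_le_of_le_ofReal (by positivity) (hKσ n i).le
  have hσ : ∀ n i, (σ (K n i)).toReal = (σ (B i)).toReal - (σ (B i \ K n i)).toReal := fun n i => by
    rw [measure_sdiff (hKB n i) (hK n i).measurableSet.nullMeasurableSet (hK n i).measure_ne_top,
      ENNReal.toReal_sub_of_le (measure_mono (hKB n i)) ((hB i).measure_lt_top σ).ne]
    ring
  have hint : ∀ C : ι → Set X, (∀ i, Bdd (C i)) →
      Integrable (fun ω => ∏ i, z i ^ count (C i) ω) P := fun C hC => by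
    have := (isTest_monomialTest hC hz).integrable_gen P
    rwa [show gen (monomialTest C z) = _ from funext (gen_monomialTest hC)] at this
  have hbound : ∀ n ω, ∏ i, z i ^ count (B i) ω ≤ ∏ i, z i ^ count (K n i) ω ∧
      ∏ i, z i ^ count (K n i) ω ≤
        ∏ i, z i ^ count (B i) ω + ∑ i, (count (B i \ K n i) ω : ℝ) := fun n ω => by
    constructor
    · refine Finset.prod_le_prod (fun i _ => pow_nonneg (hz i).1 _) fun i _ => ?_
      refine pow_le_pow_of_le_one (hz i).1 (hz i).2 ?_
      have := count_sdiff_add (hB i) (hKB n i) ω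
      omega
    -- The products differ only if some difference set contains a point; then the sum of counts is
    -- at least 1, while both products lie in [0, 1].
    · by_cases h0 : ∀ i, count (B i \ K n i) ω = 0
      · refine le_of_eq ?_
        simp only [← count_sdiff_add (hB _) (hKB n _) ω, h0]
        simp
      · push Not at h0
        obtain ⟨i, hi⟩ := h0
        have h1 : ∏ i, z i ^ count (K n i) ω ≤ 1 :=
          Finset.prod_le_one (fun i _ => pow_nonneg (hz i).1 _)
            fun i _ => pow_le_one₀ (hz i).1 (hz i).2
        have h2 : 0 ≤ ∏ i, z i ^ count (B i) ω := Finset.prod_nonneg fun i _ => pow_nonneg (hz i).1 _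
        have h3 : (count (B i \ K n i) ω : ℝ) ≤ ∑ i, (count (B i \ K n i) ω : ℝ) :=
          Finset.single_le_sum (f := fun i => (count (B i \ K n i) ω : ℝ))
            (fun i _ => Nat.cast_nonneg _) (Finset.mem_univ i)
        have h4 : (1 : ℝ) ≤ count (B i \ K n i) ω := by
          exact_mod_cast Nat.one_le_iff_ne_zero.2 hi
        linarith
  have hlim1 : Tendsto (fun n => ∫ ω, ∏ i, z i ^ count (K n i) ω ∂P) atTop
      (𝓝 (∫ ω, ∏ i, z i ^ count (B i) ω ∂P)) := by
    have hup : Tendsto (fun n => ∫ ω, ∏ i, z i ^ count (B i) ω ∂P +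
        ∑ i, (σ (B i \ K n i)).toReal) atTop (𝓝 (∫ ω, ∏ i, z i ^ count (B i) ω ∂P)) := by
      have := (tendsto_const_nhds (x := ∫ ω, ∏ i, z i ^ count (B i) ω ∂P)).add
        (tendsto_finsetSum Finset.univ fun i _ => hdσ i)
      simpa using this
    refine tendsto_of_tendsto_of_tendsto_of_le_of_le tendsto_const_nhds hup (fun n => ?_)
      (fun n => ?_)
    · exact integral_mono (hint _ hB) (hint _ (hKb n)) fun ω => (hbound n ω).1
    · have hsum : Integrable (fun ω => ∑ i, (count (B i \ K n i) ω : ℝ)) P :=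
        integrable_finsetSum _ fun i _ => hP.integrable_count (hdb n i)
      have := integral_mono (hint _ (hKb n)) ((hint _ hB).add hsum) fun ω => (hbound n ω).2
      simp only [Pi.add_apply] at this
      rw [integral_add (hint _ hB) hsum, integral_finsetSum _ fun i _ =>
        hP.integrable_count (hdb n i)] at this
      simpa only [hP.integral_count (hdb n _)] using this
  have hlim2 : Tendsto (fun n => Real.exp (-∑ i, (1 - z i) * (σ (K n i)).toReal)) atTop
      (𝓝 (Real.exp (-∑ i, (1 - z i) * (σ (B i)).toReal))) := by
    refine (Real.continuous_exp.tendsto _).comp (Tendsto.neg ?_)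
    refine tendsto_finsetSum _ fun i _ => Tendsto.const_mul _ ?_
    simp only [hσ]
    simpa using (tendsto_const_nhds (x := (σ (B i)).toReal)).sub (hdσ i)
  refine tendsto_nhds_unique hlim1 (hlim2.congr fun n => ?_)
  exact (hP.integral_prod_pow_of_isCompact (hK n)
    (fun i j hij => (hd hij).mono (hKB n i) (hKB n j)) z).symm

lemma IsTest.one_sub_eq_sum {h : X → ℝ} (hh : IsTest h) (x : X) :
    1 - h x = ∑ v : hh.finite_range.toFinset.erase 1,
      (h ⁻¹' {v.1}).indicator (fun _ => 1 - v.1) x := by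
  classical
  rw [Finset.sum_coe_sort (hh.finite_range.toFinset.erase 1)
    (fun v => (h ⁻¹' {v}).indicator (fun _ => 1 - v) x)]
  by_cases h1 : h x = 1
  · rw [h1, sub_self, Finset.sum_eq_zero]
    intro v hv
    refine Set.indicator_of_notMem ?_ _
    rintro rfl
    exact Finset.ne_of_mem_erase hv h1
  · rw [Finset.sum_eq_single (h x)]
    · simp
    · intro v _ hv
      exact Set.indicator_of_notMem (fun h => hv h.symm) _
    · intro hx
      simp [h1] at hx

lemma IsTest.integrable_one_sub {h : X → ℝ} (hh : IsTest h) (σ : Measure X)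
    [IsFiniteMeasureOnCompacts σ] : Integrable (fun x => 1 - h x) σ := by
  simp only [hh.one_sub_eq_sum]
  refine integrable_finsetSum _ fun v _ => ?_
  have hb := hh.bdd_preimage (Finset.ne_of_mem_erase v.2)
  exact (integrable_indicator_iff hb.1).2
    (integrableOn_const (hb.measure_lt_top σ).ne)

/-- The generating functional of a Poisson measure. -/
theorem IsPoissonMeasure.integral_gen (hP : IsPoissonMeasure σ P) {h : X → ℝ} (hh : IsTest h) :
    ∫ ω, gen h ω ∂P = Real.exp (-∫ x, (1 - h x) ∂σ) := by
  classical
  have hb : ∀ v : hh.finite_range.toFinset.erase 1, Bdd (h ⁻¹' {v.1}) := fun v =>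
    hh.bdd_preimage (Finset.ne_of_mem_erase v.2)
  have h1 := hP.integral_prod_pow (z := fun v : hh.finite_range.toFinset.erase 1 => v.1) hb
    (fun v w hvw => Disjoint.preimage _ (Set.disjoint_singleton.2
      (Subtype.coe_injective.ne hvw))) (fun v => by
      obtain ⟨x, hx⟩ := hh.finite_range.mem_toFinset.1 (Finset.mem_of_mem_erase v.2)
      rw [← hx]
      exact hh.mem_Icc x)
  have h2 : ∀ ω, gen h ω = ∏ v : hh.finite_range.toFinset.erase 1,
      v.1 ^ count (h ⁻¹' {v.1}) ω := fun ω => by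
    rw [hh.gen_eq_prod_pow, Finset.prod_coe_sort (hh.finite_range.toFinset.erase 1)
      (fun v => v ^ count (h ⁻¹' {v}) ω)]
  simp only [h2, h1, hh.one_sub_eq_sum]
  rw [integral_finsetSum]
  · congr 2
    refine Finset.sum_congr rfl fun v _ => ?_
    rw [integral_indicator (hb v).1, setIntegral_const, smul_eq_mul, mul_comm]
    rfl
  · intro v _
    exact (integrable_indicator_iff (hb v).1).2
      (integrableOn_const ((hb v).measure_lt_top σ).ne)

end Intensity

/-! ### The Mecke formula -/

section Mecke

variable {X : Type*} [MetricSpace X] [SigmaCompactSpace X] [MeasurableSpace X] [BorelSpace X]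
  {σ : Measure X} [IsFiniteMeasureOnCompacts σ] {P : Measure (Config X)}

lemma Bdd.union {A B : Set X} (hA : Bdd A) (hB : Bdd B) : Bdd (A ∪ B) := by
  obtain ⟨hAm, K, hK, hAK⟩ := hA
  obtain ⟨hBm, L, hL, hBL⟩ := hB
  exact ⟨hAm.union hBm, K ∪ L, hK.union hL, Set.union_subset_union hAK hBL⟩

lemma IsTest.mul {f g : X → ℝ} (hf : IsTest f) (hg : IsTest g) : IsTest fun x => f x * g x where
  measurable := hf.measurable.mul hg.measurable
  finite_range := (hf.finite_range.image2 (· * ·) hg.finite_range).subset (by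
    rintro _ ⟨x, rfl⟩
    exact ⟨f x, ⟨x, rfl⟩, g x, ⟨x, rfl⟩, rfl⟩)
  mem_Icc := fun x => ⟨mul_nonneg (hf.mem_Icc x).1 (hg.mem_Icc x).1,
    mul_le_one₀ (hf.mem_Icc x).2 (hg.mem_Icc x).1 (hg.mem_Icc x).2⟩
  bdd := (hf.bdd.union hg.bdd).mono
    ((hf.measurable.mul hg.measurable) (measurableSet_singleton 1).compl) (by
      intro x hx
      by_contra hcon
      simp only [Set.mem_union, Set.mem_ofPred_eq, not_or, not_not] at hcon
      exact hx (by simp [hcon]))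

lemma IsTest.finite_mulSupport {f : X → ℝ} (hf : IsTest f) (ω : Config X) :
    (ω.carrier ∩ Function.mulSupport f).Finite :=
  hf.bdd.finite_inter ω

lemma IsTest.gen_mul {f g : X → ℝ} (hf : IsTest f) (hg : IsTest g) (ω : Config X) :
    gen (fun x => f x * g x) ω = gen f ω * gen g ω :=
  finprod_mem_mul_distrib' (hf.finite_mulSupport ω) (hg.finite_mulSupport ω)

lemma IsTest.gen_add {f : X → ℝ} (hf : IsTest f) {ω : Config X} {x : X} (hx : x ∉ ω.carrier) :
    gen f (ω.add x) = f x * gen f ω := by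
  rw [gen, gen, carrier_add, Set.union_singleton, finprod_mem_insert' _ hx (hf.finite_mulSupport ω)]

lemma IsPoissonMeasure.ae_notMem [NullSingletonClass σ] (hP : IsPoissonMeasure σ P) (x : X) :
    ∀ᵐ ω ∂P, x ∉ ω.carrier := by
  have h := hP.lintegral_toMeasure_apply (measurableSet_singleton x)
  have hm : Measurable fun ω : Config X => ω.toMeasure {x} :=
    (Measure.measurable_coe (measurableSet_singleton x)).comp measurable_toMeasure
  rw [measure_singleton, lintegral_eq_zero_iff hm] at h
  filter_upwards [h] with ω hω hx
  rw [toMeasure_apply _ (measurableSet_singleton x), Set.inter_singleton_of_mem hx] at hω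
  simp at hω

/-- Multiplying f by z on B gives E[gen f · z^{ω(B)}] = E[gen f] · exp(-(1 - z) ∫_B f dσ);
differentiate at z = 1. -/
lemma IsPoissonMeasure.lintegral_gen_mul_count (hP : IsPoissonMeasure σ P) {f : X → ℝ}
    (hf : IsTest f) {B : Set X} (hB : Bdd B) :
    ∫⁻ ω, ENNReal.ofReal (gen f ω) * count B ω ∂P =
      ENNReal.ofReal ((∫ ω, gen f ω ∂P) * ∫ x in B, f x ∂σ) := by
  classical
  have hprob := hP.isProbabilityMeasure
  refine lintegral_mul_natCast_of_integral_pow hB.measurable_count hf.measurable_gen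
    hf.gen_mem_Icc fun z hz => ?_
  have hg := isTest_monomialTest (B := fun _ : Unit => B) (z := fun _ => z) (fun _ => hB)
    (fun _ => hz)
  have h1 : ∀ ω, gen f ω * z ^ count B ω =
      gen (fun x => f x * monomialTest (fun _ : Unit => B) (fun _ => z) x) ω := fun ω => by
    rw [hf.gen_mul hg, gen_monomialTest fun _ => hB]
    simp
  simp only [h1]
  rw [hP.integral_gen (hf.mul hg), hP.integral_gen hf, ← Real.exp_add]
  congr 1
  have hBfin : IsFiniteMeasure (σ.restrict B) := ⟨by simpa using hB.measure_lt_top σ⟩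
  have hfi : IntegrableOn f B σ :=
    Integrable.of_bound hf.measurable.aestronglyMeasurable 1 (.of_forall fun x => by
      rw [Real.norm_eq_abs, abs_of_nonneg (hf.mem_Icc x).1]
      exact (hf.mem_Icc x).2)
  have h2 : ∀ x, 1 - f x * monomialTest (fun _ : Unit => B) (fun _ => z) x =
      (1 - f x) + (1 - z) * B.indicator f x := fun x => by
    by_cases hx : x ∈ B <;> simp [monomialTest, hx]
    ring
  simp only [h2]
  rw [integral_add (hf.integrable_one_sub σ)
    (((integrable_indicator_iff hB.1).2 hfi).const_mul _), integral_const_mul,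
    integral_indicator hB.1]
  ring

/-- Mecke's formula for integrands 1_C(ω) 1_B(x). The two finite measures have equal generating
functionals, because adding an x not in ω multiplies `gen f` by `f x`, and a fixed x is almost
surely not in ω. -/
lemma IsPoissonMeasure.withDensity_count_eq [NullSingletonClass σ] (hP : IsPoissonMeasure σ P)
    {B : Set X} (hB : Bdd B) :
    P.withDensity (fun ω => (count B ω : ℝ≥0∞)) =
      (P.prod (σ.restrict B)).map (fun p => p.1.add p.2) := by
  have hprob := hP.isProbabilityMeasure
  have hBfin : IsFiniteMeasure (σ.restrict B) := ⟨by simpa using hB.measure_lt_top σ⟩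
  have hcm : Measurable fun ω : Config X => (count B ω : ℝ≥0∞) :=
    (measurable_of_countable (fun n : ℕ => (n : ℝ≥0∞))).comp hB.measurable_count
  have hfin : IsFiniteMeasure (P.withDensity (fun ω => (count B ω : ℝ≥0∞))) := by
    refine isFiniteMeasure_withDensity ?_
    simp only [← hB.toMeasure_apply]
    rw [hP.lintegral_toMeasure_apply hB.1]
    exact (hB.measure_lt_top σ).ne
  have hfin2 : IsFiniteMeasure ((P.prod (σ.restrict B)).map fun p => p.1.add p.2) :=
    Measure.isFiniteMeasure_map _ _
  refine ext_of_integral_gen fun f hf => ?_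
  have hfm : Measurable fun ω => ENNReal.ofReal (gen f ω) := hf.measurable_gen.ennreal_ofReal
  rw [integral_eq_lintegral_of_nonneg_ae (.of_forall fun ω => (hf.gen_mem_Icc ω).1)
    hf.measurable_gen.aestronglyMeasurable,
    integral_eq_lintegral_of_nonneg_ae (.of_forall fun ω => (hf.gen_mem_Icc ω).1)
    hf.measurable_gen.aestronglyMeasurable]
  congr 1
  rw [lintegral_withDensity_eq_lintegral_mul _ hcm hfm, lintegral_map hfm measurable_add,
    lintegral_prod_symm _ (Measurable.aemeasurable (by exact hfm.comp measurable_add))]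
  simp only [Pi.mul_apply]
  simp_rw [mul_comm ((count B _ : ℕ) : ℝ≥0∞)]
  rw [hP.lintegral_gen_mul_count hf hB]
  have hin : ∀ x, ∫⁻ ω, ENNReal.ofReal (gen f (ω.add x)) ∂P =
      ENNReal.ofReal (f x) * ENNReal.ofReal (∫ ω, gen f ω ∂P) := fun x => by
    rw [ofReal_integral_eq_lintegral_ofReal (hf.integrable_gen P)
      (.of_forall fun ω => (hf.gen_mem_Icc ω).1), ← lintegral_const_mul _ hfm]
    refine lintegral_congr_ae ?_
    filter_upwards [hP.ae_notMem x] with ω hω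
    rw [hf.gen_add hω, ENNReal.ofReal_mul (hf.mem_Icc x).1]
  simp only [hin]
  rw [lintegral_mul_const _ hf.measurable.ennreal_ofReal, ← ofReal_integral_eq_lintegral_ofReal,
    ← ENNReal.ofReal_mul, mul_comm]
  · exact integral_nonneg fun x => (hf.mem_Icc x).1
  · exact Integrable.of_bound hf.measurable.aestronglyMeasurable 1 (.of_forall fun x => by
      rw [Real.norm_eq_abs, abs_of_nonneg (hf.mem_Icc x).1]
      exact (hf.mem_Icc x).2)
  · exact .of_forall fun x => (hf.mem_Icc x).1

/-- The Mecke formula. -/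
theorem IsPoissonMeasure.mecke [NullSingletonClass σ] (hP : IsPoissonMeasure σ P)
    {F : Config X → X → ℝ≥0∞} (hF : Measurable (Function.uncurry F)) :
    ∫⁻ ω, ∫⁻ x, F ω x ∂ω.toMeasure ∂P = ∫⁻ ω, ∫⁻ x, F (ω.add x) x ∂σ ∂P := by
  have hprob := hP.isProbabilityMeasure
  have hm : Measurable fun p : Config X × X => (p.1.add p.2, p.2) :=
    measurable_add.prodMk measurable_snd
  have hrect : ∀ (C : Set (Config X)) (K : Set X), MeasurableSet C → IsCompact K →
      (P ⊗ₘ pointKernel X) (C ×ˢ K) =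
        ((P.prod σ).map fun p => (p.1.add p.2, p.2)) (C ×ˢ K) := by
    intro C K hC hK
    have hKb := Bdd.of_isCompact hK
    have h := congrArg (fun Q => Q C) (hP.withDensity_count_eq hKb)
    simp only [withDensity_apply _ hC] at h
    rw [Measure.compProd_apply_prod hC hK.measurableSet]
    simp only [pointKernel_apply, hKb.toMeasure_apply]
    rw [h, Measure.map_apply measurable_add hC, Measure.map_apply hm (hC.prod hK.measurableSet)]
    have hr : P.prod (σ.restrict K) = (P.prod σ).restrict (Set.univ ×ˢ K) := by
      rw [← Measure.prod_restrict, Measure.restrict_univ]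
    rw [hr, Measure.restrict_apply (measurable_add hC)]
    congr 1
    ext ⟨ω, x⟩
    simp
  -- Both sides are the two Campbell-type measures on pairs (ω, x); they agree on rectangles with
  -- compact second side.
  have key : P ⊗ₘ pointKernel X = (P.prod σ).map fun p => (p.1.add p.2, p.2) := by
    refine Measure.ext_of_generateFrom_of_iUnion
      (Set.image2 (· ×ˢ ·) {C : Set (Config X) | MeasurableSet C} {K : Set X | IsCompact K})
      (fun n => Set.univ ×ˢ compactCovering X n) ?_ ?_ ?_ ?_ ?_ ?_
    · refine (generateFrom_eq_prod MeasurableSpace.generateFrom_measurableSet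
        generateFrom_isCompact.symm ?_ ?_).symm
      · exact ⟨fun _ => Set.univ, fun _ => by simp, Set.iUnion_const _⟩
      · exact ⟨compactCovering X, isCompact_compactCovering X, iUnion_compactCovering X⟩
    · exact MeasurableSpace.isPiSystem_measurableSet.prod isPiSystem_isCompact
    · rw [← Set.prod_iUnion, iUnion_compactCovering, Set.univ_prod_univ]
    · exact fun n => ⟨_, by simp, _, isCompact_compactCovering X n, rfl⟩
    · intro n
      have hK := isCompact_compactCovering X n
      rw [Measure.compProd_apply_prod MeasurableSet.univ hK.measurableSet]
      simp only [Measure.restrict_univ, pointKernel_apply]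
      rw [hP.lintegral_toMeasure_apply hK.measurableSet]
      exact hK.measure_ne_top
    · rintro _ ⟨C, hC, K, hK, rfl⟩
      exact hrect C K hC hK
  have h1 := Measure.lintegral_compProd (μ := P) (κ := pointKernel X) hF
  simp only [Function.uncurry_apply_pair, pointKernel_apply] at h1
  rw [← h1, key, lintegral_map hF hm, lintegral_prod _ (Measurable.aemeasurable
    (by exact hF.comp hm))]
  rfl

end Mecke

/-! ### Sums over tuples of distinct points -/

section FactorialSums

variable {X : Type*} [MetricSpace X] [SigmaCompactSpace X] [MeasurableSpace X] [BorelSpace X]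

lemma measurable_finCons {α : Type*} [MeasurableSpace α] {n : ℕ} {y : α → X} {x : α → Fin n → X}
    (hy : Measurable y) (hx : Measurable x) :
    Measurable fun a => (Fin.cons (y a) (x a) : Fin (n + 1) → X) := by
  refine measurable_pi_lambda _ fun i => ?_
  refine Fin.cases ?_ (fun j => ?_) i
  · simpa using hy
  · simpa using measurable_pi_iff.1 hx j

lemma lintegral_pi_fin_succ (σ : Measure X) [SigmaFinite σ] {n : ℕ}
    {G : (Fin (n + 1) → X) → ℝ≥0∞} (hG : Measurable G) :
    ∫⁻ x, G x ∂(Measure.pi fun _ => σ) =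
      ∫⁻ x, ∫⁻ y, G (Fin.cons y x) ∂σ ∂(Measure.pi fun _ : Fin n => σ) := by
  have h := ((measurePreserving_piFinSuccAbove (fun _ : Fin (n + 1) => σ) 0).symm).lintegral_comp hG
  rw [← h, lintegral_prod_symm _ (Measurable.aemeasurable
    (by exact hG.comp (MeasurableEquiv.measurable _)))]
  refine lintegral_congr fun x => lintegral_congr fun y => ?_
  congr 1
  simp [MeasurableEquiv.piFinSuccAbove_symm_apply, Fin.insertNthEquiv, Fin.insertNth_zero']

open Classical in
/-- The sum of `K` over all `n`-tuples of distinct points of `ω`. -/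
noncomputable def factSum (ω : Config X) : (n : ℕ) → ((Fin n → X) → ℝ≥0∞) → ℝ≥0∞
  | 0, K => K Fin.elim0
  | n + 1, K => factSum ω n fun x =>
      ∫⁻ y, (if y ∈ Set.range x then 0 else K (Fin.cons y x)) ∂ω.toMeasure

open Classical in
lemma measurable_ite_mem_range {α : Type*} [MeasurableSpace α] {n : ℕ} {y : α → X}
    {x : α → Fin n → X} (hy : Measurable y) (hx : Measurable x) {F : α → ℝ≥0∞}
    (hF : Measurable F) :
    Measurable fun a => if y a ∈ Set.range (x a) then 0 else F a := by
  refine Measurable.ite ?_ measurable_const hF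
  have : {a | y a ∈ Set.range (x a)} = ⋃ i, {a | x a i = y a} := by
    ext a; simp
  rw [this]
  exact MeasurableSet.iUnion fun i =>
    measurableSet_eq_fun ((measurable_pi_apply i).comp hx) hy

open Classical in
lemma measurable_factStep {n : ℕ} {K : Config X → (Fin (n + 1) → X) → ℝ≥0∞}
    (hK : Measurable (Function.uncurry K)) :
    Measurable (Function.uncurry fun (ω : Config X) (x : Fin n → X) =>
      ∫⁻ y, (if y ∈ Set.range x then 0 else K ω (Fin.cons y x)) ∂ω.toMeasure) := by
  refine measurable_lintegral_toMeasure (α := Config X × (Fin n → X)) measurable_fst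
    (F := fun p y => if y ∈ Set.range p.2 then 0 else K p.1 (Fin.cons y p.2)) ?_
  refine measurable_ite_mem_range (α := (Config X × (Fin n → X)) × X) (y := Prod.snd)
    (x := fun p => p.1.2) measurable_snd (measurable_snd.comp measurable_fst)
    (F := fun p => K p.1.1 (Fin.cons p.2 p.1.2)) ?_
  exact hK.comp ((measurable_fst.comp measurable_fst).prodMk
    (measurable_finCons measurable_snd (measurable_snd.comp measurable_fst)))

lemma measurable_factSum {n : ℕ} {K : Config X → (Fin n → X) → ℝ≥0∞}
    (hK : Measurable (Function.uncurry K)) : Measurable fun ω => factSum ω n (K ω) := by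
  induction n with
  | zero => exact hK.comp (measurable_id.prodMk measurable_const)
  | succ n ih => exact ih (measurable_factStep hK)

open Classical in
-- The integrand vanishes at the added points, so Mecke's formula can next be applied to ω itself.
lemma lintegral_addRange_eq {n : ℕ} (ω : Config X) (x : Fin n → X) (g : X → ℝ≥0∞) :
    ∫⁻ y, (if y ∈ Set.range x then 0 else g y) ∂(ω.addRange x).toMeasure =
      ∫⁻ y, (if y ∈ Set.range x then 0 else g y) ∂ω.toMeasure := by
  rw [lintegral_toMeasure, lintegral_toMeasure,
    tsum_subtype (ω.addRange x).carrier fun y => if y ∈ Set.range x then 0 else g y,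
    tsum_subtype ω.carrier fun y => if y ∈ Set.range x then 0 else g y]
  congr 1 with y
  by_cases hy : y ∈ Set.range x
  · simp only [Set.indicator_apply, if_pos hy, ite_self]
  · simp only [Set.indicator_apply, carrier_addRange, Set.mem_union, hy, or_false]

lemma addRange_finCons {n : ℕ} (ω : Config X) (y : X) (x : Fin n → X) :
    ω.addRange (Fin.cons y x : Fin (n + 1) → X) = (ω.add y).addRange x := by
  ext w
  simp only [carrier_addRange, carrier_add, Fin.range_cons, Set.mem_union, Set.mem_insert_iff,
    Set.mem_singleton_iff]
  tauto

variable {σ : Measure X} [IsFiniteMeasureOnCompacts σ] [NullSingletonClass σ]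
  {P : Measure (Config X)}

/-- The iterated Mecke formula. -/
theorem IsPoissonMeasure.lintegral_factSum (hP : IsPoissonMeasure σ P) {n : ℕ}
    {K : Config X → (Fin n → X) → ℝ≥0∞} (hK : Measurable (Function.uncurry K)) :
    ∫⁻ ω, factSum ω n (K ω) ∂P =
      ∫⁻ ω, ∫⁻ x, K (ω.addRange x) x ∂(Measure.pi fun _ => σ) ∂P := by
  classical
  have hprob := hP.isProbabilityMeasure
  induction n with
  | zero =>
    refine lintegral_congr fun ω => ?_
    have h0 : ∀ x : Fin 0 → X, ω.addRange x = ω := fun x => by ext y; simp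
    simp only [factSum, h0]
    rw [Measure.pi_of_empty (fun _ : Fin 0 => σ) Fin.elim0, lintegral_dirac']
    exact hK.comp measurable_prodMk_left
  | succ n ih =>
    have hKr : Measurable fun p : Config X × (Fin (n + 1) → X) => K (p.1.addRange p.2) p.2 :=
      hK.comp (measurable_addRange.prodMk measurable_snd)
    simp only [factSum]
    rw [ih (measurable_factStep hK)]
    simp only [lintegral_addRange_eq]
    have hF : Measurable fun q : ((Fin n → X) × Config X) × X =>
        if q.2 ∈ Set.range q.1.1 then 0 else K (q.1.2.addRange q.1.1) (Fin.cons q.2 q.1.1) := by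
      refine measurable_ite_mem_range (y := Prod.snd)
        (x := fun q : ((Fin n → X) × Config X) × X => q.1.1) measurable_snd
        (measurable_fst.comp measurable_fst) ?_
      exact hK.comp ((measurable_addRange.comp ((measurable_snd.comp measurable_fst).prodMk
        (measurable_fst.comp measurable_fst))).prodMk
        (measurable_finCons measurable_snd (measurable_fst.comp measurable_fst)))
    -- With the tuple x outermost and fixed, the one-point Mecke formula applies in (ω, y); the
    -- order is restored afterwards.
    rw [lintegral_lintegral_swap]
    swap
    · exact (measurable_lintegral_toMeasure (α := Config X × (Fin n → X)) measurable_fst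
        (F := fun p y => if y ∈ Set.range p.2 then 0
          else K (p.1.addRange p.2) (Fin.cons y p.2))
        (hF.comp ((measurable_swap.comp measurable_fst).prodMk measurable_snd))).aemeasurable
    have hstep : ∀ x : Fin n → X,
        ∫⁻ ω, ∫⁻ y, (if y ∈ Set.range x then 0 else K (ω.addRange x) (Fin.cons y x))
          ∂ω.toMeasure ∂P =
        ∫⁻ ω, ∫⁻ y, K (ω.addRange (Fin.cons y x : Fin (n + 1) → X)) (Fin.cons y x) ∂σ ∂P := by
      intro x
      rw [hP.mecke (F := fun ω y => if y ∈ Set.range x then 0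
        else K (ω.addRange x) (Fin.cons y x))
        (hF.comp ((measurable_const.prodMk measurable_fst).prodMk measurable_snd))]
      refine lintegral_congr fun ω => lintegral_congr_ae ?_
      have hx : ∀ᵐ y ∂σ, y ∉ Set.range x :=
        measure_eq_zero_iff_ae_notMem.1 ((Set.finite_range x).measure_zero σ)
      filter_upwards [hx] with y hy
      rw [if_neg hy, addRange_finCons]
    simp only [hstep]
    rw [lintegral_lintegral_swap]
    · refine lintegral_congr fun ω => ?_
      exact (lintegral_pi_fin_succ σ (hKr.comp (measurable_prodMk_left (x := ω)))).symm
    · refine Measurable.aemeasurable ?_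
      refine Measurable.lintegral_prod_right' (f := fun q : ((Fin n → X) × Config X) × X =>
        K (q.1.2.addRange (Fin.cons q.2 q.1.1 : Fin (n + 1) → X)) (Fin.cons q.2 q.1.1)) ?_
      exact hKr.comp ((measurable_snd.comp measurable_fst).prodMk
        (measurable_finCons measurable_snd (measurable_fst.comp measurable_fst)))

end FactorialSums

/-! ### Factorial sums as sums over subsets -/

section Evaluation

/-- Double counting of pairs (U, y) with y ∈ U: each U arises from its n + 1 choices of y. -/
lemma sum_powersetCard_sum_insert {α R : Type*} [DecidableEq α] [CommSemiring R] (S : Finset α)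
    (n : ℕ) (W : Finset α → R) :
    ∑ T ∈ S.powersetCard n, ∑ y ∈ S \ T, W (insert y T) =
      (n + 1) * ∑ U ∈ S.powersetCard (n + 1), W U := by
  have h1 : (n + 1) * ∑ U ∈ S.powersetCard (n + 1), W U =
      ∑ U ∈ S.powersetCard (n + 1), ∑ y ∈ U, W U := by
    rw [Finset.mul_sum]
    refine Finset.sum_congr rfl fun U hU => ?_
    rw [Finset.sum_const, (Finset.mem_powersetCard.1 hU).2]
    simp
  rw [h1, Finset.sum_sigma', Finset.sum_sigma']
  refine Finset.sum_nbij' (fun p => ⟨insert p.2 p.1, p.2⟩) (fun p => ⟨p.1.erase p.2, p.2⟩)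
    ?_ ?_ ?_ ?_ ?_
  · rintro ⟨T, y⟩ h
    simp only [Finset.mem_sigma, Finset.mem_powersetCard, Finset.mem_sdiff] at h ⊢
    refine ⟨⟨Finset.insert_subset h.2.1 h.1.1, ?_⟩, Finset.mem_insert_self _ _⟩
    rw [Finset.card_insert_of_notMem h.2.2, h.1.2]
  · rintro ⟨U, y⟩ h
    simp only [Finset.mem_sigma, Finset.mem_powersetCard, Finset.mem_sdiff] at h ⊢
    refine ⟨⟨(Finset.erase_subset _ _).trans h.1.1, ?_⟩, h.1.1 h.2, Finset.notMem_erase _ _⟩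
    rw [Finset.card_erase_of_mem h.2, h.1.2]
    simp
  · rintro ⟨T, y⟩ h
    simp only [Finset.mem_sigma, Finset.mem_sdiff] at h
    simp [Finset.erase_insert h.2.2]
  · rintro ⟨U, y⟩ h
    simp only [Finset.mem_sigma] at h
    simp [Finset.insert_erase h.2]
  · rintro ⟨T, y⟩ _
    rfl

variable {X : Type*} [MetricSpace X] [SigmaCompactSpace X] [MeasurableSpace X] [BorelSpace X]

open Classical in
-- A symmetric kernel sees only the set of its arguments, and each n-subset has n! orderings. In the
-- induction, W is replaced by its sum over one-point extensions inside S.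
lemma factSum_eq_sum_powersetCard (ω : Config X) (S : Finset X)
    (hS : ∀ x ∈ S, x ∈ ω.carrier) {n : ℕ} (K : (Fin n → X) → ℝ≥0∞) (W : Finset X → ℝ≥0∞)
    (hKW : ∀ x : Fin n → X, Function.Injective x → (∀ i, x i ∈ ω.carrier) →
      K x = W (Finset.univ.image x))
    (hW : ∀ T, ¬ T ⊆ S → W T = 0) :
    factSum ω n K = n.factorial * ∑ T ∈ S.powersetCard n, W T := by
  induction n generalizing W with
  | zero =>
    simp [factSum, hKW Fin.elim0 (Function.injective_of_subsingleton _) (fun i => i.elim0)]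
  | succ n ih =>
    rw [factSum, ih _ (fun T => ∑ y ∈ S \ T, W (insert y T)), sum_powersetCard_sum_insert]
    · rw [Nat.factorial_succ]
      push_cast
      ring
    · intro x hx hxω
      rw [lintegral_toMeasure,
        tsum_subtype ω.carrier fun y => if y ∈ Set.range x then 0 else K (Fin.cons y x)]
      have hpt : ∀ y, ω.carrier.indicator
          (fun y => if y ∈ Set.range x then 0 else K (Fin.cons y x)) y =
          if y ∈ S \ Finset.univ.image x then W (insert y (Finset.univ.image x)) else 0 := by
        intro y
        by_cases hyω : y ∈ ω.carrier
        · rw [Set.indicator_of_mem hyω]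
          by_cases hyx : y ∈ Set.range x
          · rw [if_pos hyx, if_neg]
            simpa using fun _ => hyx
          · have hK : K (Fin.cons y x) = W (insert y (Finset.univ.image x)) := by
              rw [hKW _ (Fin.cons_injective_iff.2 ⟨hyx, hx⟩)
                (Fin.cases (by simpa using hyω) (by simpa using hxω))]
              congr 1
              ext w
              simp [Fin.exists_fin_succ, eq_comm]
            rw [if_neg hyx, hK]
            by_cases hyS : y ∈ S
            · rw [if_pos]
              simpa [hyS] using hyx
            · rw [if_neg (fun h => hyS (Finset.mem_sdiff.1 h).1), hW]
              exact fun h => hyS (h (Finset.mem_insert_self _ _))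
        · rw [Set.indicator_of_notMem hyω, if_neg]
          exact fun h => hyω (hS y (Finset.mem_sdiff.1 h).1)
      simp only [hpt]
      rw [tsum_eq_sum (s := S \ Finset.univ.image x) (fun y hy => if_neg hy)]
      exact Finset.sum_congr rfl fun y hy => if_pos hy
    · intro T hT
      refine Finset.sum_eq_zero fun y _ => hW _ fun h => hT ?_
      exact (Finset.subset_insert _ _).trans h

lemma factSum_prod_eq (ω : Config X) (S : Finset X) (g : X → ℝ≥0∞)
    (hS : ∀ x ∈ S, x ∈ ω.carrier) (hg : ∀ x ∈ ω.carrier, x ∉ S → g x = 0) (n : ℕ) :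
    factSum ω n (fun x => ∏ i, g (x i)) =
      n.factorial * ∑ T ∈ S.powersetCard n, ∏ x ∈ T, g x := by
  classical
  rw [factSum_eq_sum_powersetCard ω S hS _ (fun T => if T ⊆ S then ∏ x ∈ T, g x else 0)]
  · congr 1
    exact Finset.sum_congr rfl fun T hT => if_pos (Finset.mem_powersetCard.1 hT).1
  · intro x hx hxω
    split_ifs with h
    · rw [Finset.prod_image fun i _ j _ hij => hx hij]
    · obtain ⟨y, hy, hyS⟩ := Finset.not_subset.1 h
      obtain ⟨i, -, rfl⟩ := Finset.mem_image.1 hy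
      exact Finset.prod_eq_zero (Finset.mem_univ i) (hg _ (hxω i) hyS)
  · intro T hT
    exact if_neg hT

end Evaluation

/-! ### The image process: moments, generating functional, collisions -/

section Image

variable {X Y : Type*} [MetricSpace X] [SigmaCompactSpace X] [MeasurableSpace X] [BorelSpace X]
  [MetricSpace Y] [SigmaCompactSpace Y] [MeasurableSpace Y] [BorelSpace Y]
  {σ : Measure X} {μ : Measure Y} {P : Measure (Config X)} {τ : Config X → X → Y}

lemma imageMeasure_apply (τ : Config X → X → Y) (ω : Config X) {B : Set Y}
    (hB : MeasurableSet B) :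
    imageMeasure τ ω B = ∫⁻ x, B.indicator 1 (τ ω x) ∂ω.toMeasure := by
  rw [lintegral_toMeasure, imageMeasure, Measure.sum_apply _ hB]
  exact tsum_congr fun x => Measure.dirac_apply' _ hB

lemma measurable_imageMeasure (hτ : Measurable (Function.uncurry τ)) :
    Measurable (imageMeasure τ) := by
  refine Measure.measurable_of_measurable_coe _ fun B hB => ?_
  simp only [imageMeasure_apply τ _ hB]
  exact measurable_lintegral_toMeasure (F := fun ω x => B.indicator 1 (τ ω x)) measurable_id
    ((measurable_one.indicator hB).comp hτ)

lemma CyclicCondition.add_self (hcyc : CyclicCondition τ) (ω : Config X) (x : X) :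
    τ (ω.add x) x = τ ω x := by
  obtain ⟨i, hi⟩ := hcyc 0 ω fun _ => x
  exact hi

variable [IsFiniteMeasureOnCompacts σ] [NullSingletonClass σ]

/-- Mecke's formula adds x to ω, and the cyclic condition with k = 1 removes it again from `τ (ω.add
x) x`. -/
lemma IsPoissonMeasure.lintegral_imageMeasure (hP : IsPoissonMeasure σ P)
    (hτ : Measurable (Function.uncurry τ)) (hpush : ∀ ω, σ.map (τ ω) = μ)
    (hcyc : CyclicCondition τ) {B : Set Y} (hB : MeasurableSet B) :
    ∫⁻ ω, imageMeasure τ ω B ∂P = μ B := by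
  have hprob := hP.isProbabilityMeasure
  simp only [imageMeasure_apply τ _ hB]
  rw [hP.mecke (F := fun ω x => B.indicator 1 (τ ω x)) ((measurable_one.indicator hB).comp hτ)]
  have : ∀ ω : Config X, ∫⁻ x, B.indicator 1 (τ (ω.add x) x) ∂σ = μ B := fun ω => by
    have hτω : Measurable (τ ω) := hτ.comp measurable_prodMk_left
    simp only [hcyc.add_self]
    rw [← lintegral_map (measurable_one.indicator hB) hτω, hpush,
      lintegral_indicator_one hB]
  simp [this]

lemma IsPoissonMeasure.ae_finite_preimage (hP : IsPoissonMeasure σ P)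
    (hτ : Measurable (Function.uncurry τ)) (hpush : ∀ ω, σ.map (τ ω) = μ)
    (hcyc : CyclicCondition τ) {B : Set Y} (hB : MeasurableSet B) (hfin : μ B ≠ ∞) :
    ∀ᵐ ω ∂P, {x | x ∈ ω.carrier ∧ τ ω x ∈ B}.Finite := by
  have h := hP.lintegral_imageMeasure hτ hpush hcyc hB
  have hm : Measurable fun ω => imageMeasure τ ω B :=
    (Measure.measurable_coe hB).comp (measurable_imageMeasure hτ)
  filter_upwards [ae_lt_top hm (h ▸ hfin)] with ω hω
  rw [imageMeasure_apply τ _ hB, lintegral_toMeasure] at hω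
  have := (ENNReal.finite_const_le_of_tsum_ne_top hω.ne one_ne_zero).image Subtype.val
  refine this.subset ?_
  rintro x ⟨hx, hxB⟩
  exact ⟨⟨x, hx⟩, by simp [hxB], rfl⟩

/-- The generating functional of the image process. -/
theorem IsPoissonMeasure.integral_finprod_image [IsFiniteMeasureOnCompacts μ]
    (hP : IsPoissonMeasure σ P)
    (hτ : Measurable (Function.uncurry τ)) (hpush : ∀ ω, σ.map (τ ω) = μ)
    (hcyc : CyclicCondition τ) {h : Y → ℝ} (hh : IsTest h) :
    ∫ ω, ∏ᶠ x ∈ ω.carrier, h (τ ω x) ∂P = Real.exp (-∫ y, (1 - h y) ∂μ) := by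
  classical
  have hprob := hP.isProbabilityMeasure
  have h0 : ∀ y, 0 ≤ 1 - h y := fun y => sub_nonneg.2 (hh.mem_Icc y).2
  let f : Y → ℝ≥0∞ := fun y => ENNReal.ofReal (1 - h y)
  have hf : Measurable f := (measurable_const.sub hh.measurable).ennreal_ofReal
  set m := ∫ y, (1 - h y) ∂μ with hm
  have hm0 : 0 ≤ m := integral_nonneg h0
  have hfm : ∫⁻ y, f y ∂μ = ENNReal.ofReal m :=
    (ofReal_integral_eq_lintegral_ofReal (hh.integrable_one_sub μ) (.of_forall h0)).symm
  let K : (n : ℕ) → Config X → (Fin n → X) → ℝ≥0∞ := fun n ω x => ∏ i, f (τ ω (x i))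
  have hK : ∀ n, Measurable (Function.uncurry (K n)) := fun n =>
    Finset.measurable_fun_prod _ fun i _ => hf.comp (hτ.comp
      (measurable_fst.prodMk ((measurable_pi_apply i).comp measurable_snd)))
  let D : ℕ → Config X → ℝ≥0∞ := fun n ω => factSum ω n (K n ω)
  have hDm : ∀ n, Measurable (D n) := fun n => measurable_factSum (hK n)
  have hD : ∀ n, ∫⁻ ω, D n ω ∂P = ENNReal.ofReal m ^ n := fun n => by
    simp only [D]
    rw [hP.lintegral_factSum (hK n)]
    have : ∀ ω : Config X, ∫⁻ x, K n (ω.addRange x) x ∂(Measure.pi fun _ => σ) = ENNReal.ofReal m ^ n :=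
      fun ω => by
        have := hcyc.lintegral_prod_addRange hτ hpush hf (by simp [hfm]) (ι := Fin n) ω
        rwa [hfm, Fintype.card_fin] at this
    simp [this]
  have hDfin : ∀ n, ∫⁻ ω, D n ω ∂P ≠ ∞ := fun n => by
    rw [hD]; exact ENNReal.pow_ne_top ENNReal.ofReal_ne_top
  have hDint : ∀ n, ∫ ω, (D n ω).toReal ∂P = m ^ n := fun n => by
    rw [integral_toReal (hDm n).aemeasurable (ae_lt_top (hDm n) (hDfin n)), hD,
      ENNReal.toReal_pow, ENNReal.toReal_ofReal hm0]
  -- The degree-n term of the expansion of ∏ (1 - f). Its L¹ norm is m^n / n!, so the series may be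
  -- integrated term by term.
  let A : ℕ → Config X → ℝ := fun n ω => (-1) ^ n / n.factorial * (D n ω).toReal
  have hAint : ∀ n, Integrable (A n) P := fun n =>
    (integrable_toReal_of_lintegral_ne_top (hDm n).aemeasurable (hDfin n)).const_mul _
  have hAI : ∀ n, ∫ ω, A n ω ∂P = (-m) ^ n / n.factorial := fun n => by
    simp only [A]
    rw [integral_const_mul, hDint, neg_pow m]
    ring
  have hAn : ∀ n, ∫ ω, ‖A n ω‖ ∂P = m ^ n / n.factorial := fun n => by
    have : ∀ ω, ‖A n ω‖ = 1 / n.factorial * (D n ω).toReal := fun ω => by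
      simp [A, abs_of_nonneg ENNReal.toReal_nonneg]
    simp only [this]
    rw [integral_const_mul, hDint]
    ring
  have hsum := hasSum_integral_of_summable_integral_norm hAint (by
    simp only [hAn]
    exact Real.summable_pow_div_factorial m)
  simp only [hAI] at hsum
  have hexp : HasSum (fun n : ℕ => (-m) ^ n / (n.factorial : ℝ)) (Real.exp (-m)) := by
    rw [Real.exp_eq_exp_ℝ]
    exact NormedSpace.expSeries_div_hasSum_exp (-m)
  rw [← hsum.unique hexp]
  refine integral_congr_ae ?_
  filter_upwards [hP.ae_finite_preimage hτ hpush hcyc hh.bdd.1 (hh.bdd.measure_lt_top μ).ne]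
    with ω hω
  have hS : ∀ x, x ∈ hω.toFinset ↔ x ∈ ω.carrier ∧ h (τ ω x) ≠ 1 := by simp
  generalize hω.toFinset = S at hS
  have hprod : ∏ᶠ x ∈ ω.carrier, h (τ ω x) = ∏ x ∈ S, h (τ ω x) :=
    gen_eq_prod (h := fun x => h (τ ω x)) (fun x hx => ((hS x).1 hx).1)
      (fun x hx hx1 => (hS x).2 ⟨hx, hx1⟩)
  have hDS : ∀ n, A n ω = ∑ T ∈ S.powersetCard n, ∏ x ∈ T, (-(1 - h (τ ω x))) := fun n => by
    have h1 : D n ω = n.factorial * ∑ T ∈ S.powersetCard n, ∏ x ∈ T, f (τ ω x) :=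
      factSum_prod_eq ω S (fun x => f (τ ω x)) (fun x hx => ((hS x).1 hx).1)
        (fun x hx hxS => by
          have : h (τ ω x) = 1 := by
            by_contra hne
            exact hxS ((hS x).2 ⟨hx, hne⟩)
          simp [f, this]) n
    have h2 : (D n ω).toReal =
        n.factorial * ∑ T ∈ S.powersetCard n, ∏ x ∈ T, (1 - h (τ ω x)) := by
      rw [h1, ENNReal.toReal_mul, ENNReal.toReal_natCast, ENNReal.toReal_sum]
      · congr 1
        refine Finset.sum_congr rfl fun T _ => ?_
        rw [ENNReal.toReal_prod]
        exact Finset.prod_congr rfl fun x _ => ENNReal.toReal_ofReal (h0 _)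
      · exact fun T _ => ENNReal.prod_ne_top fun x _ => ENNReal.ofReal_ne_top
    have hn : (n.factorial : ℝ) ≠ 0 := by positivity
    simp only [A]
    rw [h2, ← mul_assoc, div_mul_cancel₀ _ hn, Finset.mul_sum]
    refine Finset.sum_congr rfl fun T hT => ?_
    rw [Finset.prod_neg, (Finset.mem_powersetCard.1 hT).2]
  -- Only finitely many points have `h ≠ 1`; degrees above their number vanish, and the rest is the
  -- subset expansion of a finite product.
  rw [hprod, tsum_eq_sum (s := Finset.range (S.card + 1))]
  · simp only [hDS]
    rw [← Finset.sum_powerset S fun T => ∏ x ∈ T, (-(1 - h (τ ω x))), ← Finset.prod_one_add]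
    exact Finset.prod_congr rfl fun x _ => by ring
  · intro n hn
    rw [Finset.mem_range, not_lt] at hn
    rw [hDS, Finset.powersetCard_eq_empty.2 hn, Finset.sum_empty]

lemma CyclicCondition.addRange_pair (hcyc : CyclicCondition τ) (ω : Config X) (a b : X) :
    τ (ω.addRange ![a, b]) a = τ (ω.add b) a ∧ τ (ω.addRange ![a, b]) b = τ (ω.add a) b := by
  constructor
  · rw [← hcyc.add_self (ω.add b) a]
    congr 1
    ext y
    simp [or_left_comm]
  · rw [← hcyc.add_self (ω.add a) b]
    congr 1
    ext y
    simp [or_left_comm]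

lemma CyclicCondition.add_eq_or (hcyc : CyclicCondition τ) (ω : Config X) (a b : X) :
    τ (ω.add b) a = τ ω a ∨ τ (ω.add a) b = τ ω b := by
  obtain ⟨i, hi⟩ := hcyc 1 ω ![a, b]
  fin_cases i
  · exact .inr hi
  · exact .inl hi

/-- Two added points almost never collide after the transformation. -/
lemma CyclicCondition.lintegral_collision [NullSingletonClass μ] [DecidableEq Y]
    (hcyc : CyclicCondition τ)
    (hτ : Measurable (Function.uncurry τ)) (hpush : ∀ ω, σ.map (τ ω) = μ) (ω : Config X) :
    ∫⁻ x, (if τ (ω.addRange x) (x 0) = τ (ω.addRange x) (x 1) then (1 : ℝ≥0∞) else 0)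
      ∂(Measure.pi fun _ : Fin 2 => σ) = 0 := by
  have hτω : ∀ ω, Measurable (τ ω) := fun ω => hτ.comp measurable_prodMk_left
  have hnull : ∀ (ω : Config X) (c : Y), ∀ᵐ x ∂σ, τ ω x ≠ c := fun ω c => by
    have h1 : μ {c} = 0 := measure_singleton c
    rw [← hpush ω, Measure.map_apply (hτω ω) (measurableSet_singleton c)] at h1
    exact measure_eq_zero_iff_ae_notMem.1 h1
  have hadd₁ : Measurable fun p : X × X => τ (ω.add p.1) p.2 :=
    hτ.comp ((measurable_add.comp (measurable_const.prodMk measurable_fst)).prodMk measurable_snd)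
  have hae : ∀ᵐ p ∂(σ.prod σ), τ (ω.add p.2) p.1 ≠ τ (ω.add p.1) p.2 := by
    have h1 : ∀ᵐ p ∂(σ.prod σ), τ ω p.1 ≠ τ (ω.add p.1) p.2 := by
      have hs : MeasurableSet {p : X × X | τ ω p.1 ≠ τ (ω.add p.1) p.2} :=
        (measurableSet_eq_fun ((hτω ω).comp measurable_fst) hadd₁).compl
      rw [Measure.ae_prod_iff_ae_ae hs]
      -- For fixed a, the law of `τ (ω.add a)` under σ is μ, which does not charge the point `τ ω
      -- a`.
      exact .of_forall fun a => (hnull (ω.add a) (τ ω a)).mono fun b hb => hb.symm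
    have h2 : ∀ᵐ p ∂(σ.prod σ), τ ω p.2 ≠ τ (ω.add p.2) p.1 := by
      have := Measure.measurePreserving_swap (μ := σ) (ν := σ)
      exact this.quasiMeasurePreserving.ae h1
    -- The cyclic condition with k = 2 leaves one of the two images unaffected by the other point; a
    -- collision then falls into one of the null sets.
    filter_upwards [h1, h2] with p hp1 hp2 heq
    rcases hcyc.add_eq_or ω p.1 p.2 with h | h
    · exact hp1 (h ▸ heq)
    · exact hp2 ((heq.trans h).symm)
  have hmp := measurePreserving_finTwoArrow (μ := σ)
  have := hmp.quasiMeasurePreserving.ae hae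
  rw [lintegral_eq_zero_of_ae_eq_zero]
  filter_upwards [this] with x hx
  have hxe : x = ![x 0, x 1] := by ext i; fin_cases i <;> rfl
  have h3 := hcyc.addRange_pair ω (x 0) (x 1)
  rw [← hxe] at h3
  rw [h3.1, h3.2]
  exact if_neg hx

/-- By the two-point Mecke formula, the expected number of ordered pairs of distinct colliding
points is zero. -/
lemma IsPoissonMeasure.ae_injOn [NullSingletonClass μ] (hP : IsPoissonMeasure σ P)
    (hτ : Measurable (Function.uncurry τ)) (hpush : ∀ ω, σ.map (τ ω) = μ)
    (hcyc : CyclicCondition τ) : ∀ᵐ ω ∂P, Set.InjOn (τ ω) ω.carrier := by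
  classical
  let K : Config X → (Fin 2 → X) → ℝ≥0∞ := fun ω x => if τ ω (x 0) = τ ω (x 1) then 1 else 0
  have hK : Measurable (Function.uncurry K) := by
    have : ∀ i : Fin 2, Measurable fun p : Config X × (Fin 2 → X) => τ p.1 (p.2 i) := fun i =>
      hτ.comp (measurable_fst.prodMk ((measurable_pi_apply i).comp measurable_snd))
    exact Measurable.ite (measurableSet_eq_fun (this 0) (this 1)) measurable_const measurable_const
  have h := hP.lintegral_factSum hK
  have h0 : ∀ ω : Config X, ∫⁻ x, K (ω.addRange x) x ∂(Measure.pi fun _ => σ) = 0 := fun ω =>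
    hcyc.lintegral_collision hτ hpush ω
  simp only [h0, lintegral_zero] at h
  rw [lintegral_eq_zero_iff (measurable_factSum hK)] at h
  filter_upwards [h] with ω hω a ha b hb hab
  by_contra hne
  simp only [factSum, Pi.zero_apply, lintegral_toMeasure, ENNReal.tsum_eq_zero] at hω
  have h1 := hω ⟨b, hb⟩
  rw [if_neg (by simp), ENNReal.tsum_eq_zero] at h1
  have h2 := h1 ⟨a, ha⟩
  rw [if_neg (by simpa [Set.mem_range, Fin.exists_fin_one] using hne)] at h2
  simp [K, hab] at h2

end Image

/-! ### Local finiteness of the target measure -/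

section LocallyFinite

variable {Y : Type*} [MetricSpace Y] [SigmaCompactSpace Y] [MeasurableSpace Y] [BorelSpace Y]

open Filter Topology in
-- An ultrafilter on the union either contains some `C n`, or avoids each of them and is pushed into
-- ever smaller balls around y.
lemma isCompact_insert_iUnion {C : ℕ → Set Y} (hC : ∀ n, IsCompact (C n)) (y : Y) {r : ℕ → ℝ}
    (hr : Antitone r) (hr0 : Tendsto r atTop (𝓝 0)) (hCr : ∀ n, C n ⊆ Metric.closedBall y (r n)) :
    IsCompact (insert y (⋃ n, C n)) := by
  rw [isCompact_iff_ultrafilter_le_nhds]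
  intro f hf
  by_cases h : ∃ n, C n ∈ f
  · obtain ⟨n, hn⟩ := h
    obtain ⟨x, hx, hfx⟩ := isCompact_iff_ultrafilter_le_nhds.1 (hC n) f (le_principal_iff.2 hn)
    exact ⟨x, Or.inr (Set.mem_iUnion.2 ⟨n, hx⟩), hfx⟩
  · push Not at h
    refine ⟨y, Or.inl rfl, Metric.nhds_basis_closedBall.ge_iff.2 fun ε hε => ?_⟩
    obtain ⟨N, hN⟩ := (hr0.eventually (gt_mem_nhds hε)).exists
    have h1 : ∀ n ∈ Finset.range N, (C n)ᶜ ∈ f := fun n _ =>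
      Ultrafilter.compl_mem_iff_notMem.2 (h n)
    have h2 : (⋂ n ∈ Finset.range N, (C n)ᶜ) ∈ f :=
      (Filter.biInter_finset_mem (Finset.range N)).2 h1
    filter_upwards [h2, le_principal_iff.1 hf] with x hx hxK
    rcases hxK with rfl | hxC
    · exact Metric.mem_closedBall_self hε.le
    · obtain ⟨n, hn⟩ := Set.mem_iUnion.1 hxC
      have hNn : N ≤ n := by
        by_contra hlt
        exact Set.mem_iInter₂.1 hx n (Finset.mem_range.2 (not_le.1 hlt)) hn
      exact Metric.closedBall_subset_closedBall ((hr hNn).trans hN.le) (hCr n hn)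

open Filter Topology in
/-- In a σ-compact metric space, measures finite on compact sets are locally finite. -/
lemma isLocallyFiniteMeasure_of_sigmaCompact (μ : Measure Y) [IsFiniteMeasureOnCompacts μ] :
    IsLocallyFiniteMeasure μ := by
  refine ⟨fun y => ?_⟩
  by_contra hcon
  have hcon' : ∀ s ∈ 𝓝 y, μ s = ∞ := fun s hs => by
    by_contra hne
    exact hcon ⟨s, hs, lt_top_iff_ne_top.2 hne⟩
  let r : ℕ → ℝ := fun n => 1 / ((n : ℝ) + 1)
  have hr0 : Tendsto r atTop (𝓝 0) := tendsto_one_div_add_atTop_nhds_zero_nat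
  have hr : Antitone r := fun m n hmn => one_div_le_one_div_of_le (by positivity) (by gcongr)
  -- If every ball around y has infinite mass, compact sets of mass at least n fit into shrinking
  -- balls; with y they form a compact set of infinite mass.
  have hex : ∀ n : ℕ, ∃ C : Set Y, IsCompact C ∧ C ⊆ Metric.closedBall y (r n) ∧ (n : ℝ≥0∞) ≤ μ C := by
    intro n
    have h1 : μ (⋃ k, Metric.closedBall y (r n) ∩ compactCovering Y k) = ∞ := by
      rw [← Set.inter_iUnion, iUnion_compactCovering, Set.inter_univ]
      exact hcon' _ (Metric.closedBall_mem_nhds y (by positivity))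
    rw [Monotone.measure_iUnion fun i j hij =>
      Set.inter_subset_inter_right _ (compactCovering_subset Y hij)] at h1
    obtain ⟨k, hk⟩ := lt_iSup_iff.1 (h1 ▸ ENNReal.natCast_lt_top n)
    exact ⟨_, (isCompact_compactCovering Y k).inter_left Metric.isClosed_closedBall,
      Set.inter_subset_left, hk.le⟩
  choose C hC hCr hCn using hex
  have hK := isCompact_insert_iUnion hC y hr hr0 hCr
  obtain ⟨n, hn⟩ := ENNReal.exists_nat_gt (hK.measure_ne_top (μ := μ))
  refine absurd ((hCn n).trans (measure_mono ?_)) (not_le.2 hn)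
  exact (Set.subset_iUnion C n).trans (Set.subset_insert _ _)

end LocallyFinite

/-! ### Poisson measures from their generating functional -/

section Characterization

variable {Y : Type*} [MetricSpace Y] [SigmaCompactSpace Y] [MeasurableSpace Y] [BorelSpace Y]
  {μ : Measure Y} [IsFiniteMeasureOnCompacts μ] {Q : Measure (Config Y)}

lemma one_sub_monomialTest {ι : Type*} [Fintype ι] {A : ι → Set Y}
    (hd : Pairwise fun i j => Disjoint (A i) (A j)) (z : ι → ℝ) (y : Y) :
    1 - monomialTest A z y = ∑ i, (A i).indicator (fun _ => 1 - z i) y := by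
  classical
  by_cases h : ∃ i, y ∈ A i
  · obtain ⟨i, hi⟩ := h
    have hj : ∀ j, j ≠ i → y ∉ A j := fun j hji hyj => (hd hji).le_bot ⟨hyj, hi⟩
    rw [monomialTest, Finset.prod_eq_single i (fun j _ hji => if_neg (hj j hji)) (by simp),
      Finset.sum_eq_single i (fun j _ hji => Set.indicator_of_notMem (hj j hji) _) (by simp),
      if_pos hi, Set.indicator_of_mem hi]
  · push Not at h
    simp [monomialTest, h]

lemma integral_one_sub_monomialTest {ι : Type*} [Fintype ι] {A : ι → Set Y} (hA : ∀ i, Bdd (A i))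
    (hd : Pairwise fun i j => Disjoint (A i) (A j)) (z : ι → ℝ) :
    ∫ y, (1 - monomialTest A z y) ∂μ = ∑ i, (1 - z i) * (μ (A i)).toReal := by
  simp only [one_sub_monomialTest hd]
  rw [integral_finsetSum]
  · refine Finset.sum_congr rfl fun i _ => ?_
    rw [integral_indicator (hA i).1, setIntegral_const, smul_eq_mul, mul_comm]
    rfl
  · intro i _
    exact (integrable_indicator_iff (hA i).1).2
      (integrableOn_const ((hA i).measure_lt_top μ).ne)

lemma map_count_eq_pi [IsProbabilityMeasure Q]
    (h : ∀ f : Y → ℝ, IsTest f → ∫ ω, gen f ω ∂Q = Real.exp (-∫ y, (1 - f y) ∂μ))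
    {ι : Type*} [Fintype ι] {A : ι → Set Y} (hA : ∀ i, Bdd (A i))
    (hd : Pairwise fun i j => Disjoint (A i) (A j)) :
    Q.map (fun ω i => count (A i) ω) =
      Measure.pi fun i => poissonMeasure (μ (A i)).toNNReal := by
  have hm : Measurable fun (ω : Config Y) i => count (A i) ω :=
    measurable_pi_lambda _ fun i => (hA i).measurable_count
  have := Measure.isProbabilityMeasure_map (μ := Q) hm.aemeasurable
  refine ext_of_integral_prod_pow fun z hz => ?_
  rw [integral_map hm.aemeasurable (measurable_of_countable _).aestronglyMeasurable,
    integral_fintype_prod_eq_prod (f := fun i (n : ℕ) => z i ^ n)]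
  simp only [integral_pow_poissonMeasure, ← gen_monomialTest hA]
  rw [h _ (isTest_monomialTest hA hz), integral_one_sub_monomialTest hA hd,
    ← Finset.sum_neg_distrib, Real.exp_sum]
  rfl

/-- A probability measure with the generating functional of a Poisson measure is Poisson. -/
lemma isPoissonMeasure_of_integral_gen [IsProbabilityMeasure Q]
    (h : ∀ f : Y → ℝ, IsTest f → ∫ ω, gen f ω ∂Q = Real.exp (-∫ y, (1 - f y) ∂μ)) :
    IsPoissonMeasure μ Q := by
  have hlaw : ∀ A : Set Y, IsCompact A → Q.map (count A) = poissonMeasure (μ A).toNNReal := by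
    intro A hA
    have hb := Bdd.of_isCompact hA
    have h1 := map_count_eq_pi h (ι := Unit) (A := fun _ => A) (fun _ => hb)
      (fun i j hij => absurd (Subsingleton.elim i j) hij)
    have h2 := congrArg (fun ν => ν.map (Function.eval ())) h1
    simp only [(measurePreserving_eval (fun _ : Unit => poissonMeasure (μ A).toNNReal)
      ()).map_eq] at h2
    rw [Measure.map_map (measurable_pi_apply _)
      (measurable_pi_lambda _ fun _ => hb.measurable_count)] at h2
    exact h2
  refine ⟨inferInstance, fun A hA => ⟨(Bdd.of_isCompact hA).measurable_count.aemeasurable,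
    hlaw A hA⟩, fun n A hA hd => ?_⟩
  rw [iIndepFun_iff_map_fun_eq_pi_map fun i =>
    (Bdd.of_isCompact (hA i)).measurable_count.aemeasurable]
  simp only [fun i => hlaw (A i) (hA i)]
  exact map_count_eq_pi h (fun i => Bdd.of_isCompact (hA i)) hd

end Characterization

/-! ### The transformation as a map into configurations -/

section Push

variable {X Y : Type*} [MetricSpace X] [SigmaCompactSpace X] [MeasurableSpace X] [BorelSpace X]
  [MetricSpace Y] [SigmaCompactSpace Y] [MeasurableSpace Y] [BorelSpace Y]
  {σ : Measure X} [IsFiniteMeasureOnCompacts σ] [NullSingletonClass σ]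
  {μ : Measure Y} [IsFiniteMeasureOnCompacts μ] [NullSingletonClass μ]
  {P : Measure (Config X)} {τ : Config X → X → Y}

/-- Almost surely, no two points collide and the image is locally finite. -/
lemma IsPoissonMeasure.ae_injOn_and_finite (hP : IsPoissonMeasure σ P)
    (hτ : Measurable (Function.uncurry τ)) (hpush : ∀ ω, σ.map (τ ω) = μ)
    (hcyc : CyclicCondition τ) :
    ∀ᵐ ω ∂P, Set.InjOn (τ ω) ω.carrier ∧
      ∀ K : Set Y, IsCompact K → ((τ ω '' ω.carrier) ∩ K).Finite := by
  have := isLocallyFiniteMeasure_of_sigmaCompact μ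
  -- One null set must serve all compact K at once. A countable open cover of finite measure does
  -- this, since each K meets finitely many members of a subcover; Y need not be locally compact, so
  -- a compact exhaustion might not absorb K.
  let U := μ.finiteSpanningSetsInOpen'
  have hU : ∀ n, IsOpen (U.set n) := U.set_mem
  have hfin : ∀ᵐ ω ∂P, ∀ n, {x | x ∈ ω.carrier ∧ τ ω x ∈ U.set n}.Finite :=
    ae_all_iff.2 fun n =>
      hP.ae_finite_preimage hτ hpush hcyc (hU n).measurableSet (U.finite n).ne
  filter_upwards [hP.ae_injOn hτ hpush hcyc, hfin] with ω hinj hω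
  refine ⟨hinj, fun K hK => ?_⟩
  obtain ⟨t, ht⟩ := hK.elim_finite_subcover U.set hU (by simp [U.spanning])
  refine (t.finite_toSet.biUnion fun n _ => (hω n).image (τ ω)).subset ?_
  rintro _ ⟨⟨x, hx, rfl⟩, hxK⟩
  obtain ⟨n, hn, hxn⟩ := Set.mem_iUnion₂.1 (ht hxK)
  exact Set.mem_iUnion₂.2 ⟨n, hn, x, ⟨hx, hxn⟩, rfl⟩

lemma carrier_push {ω : Config X} (h : Set.InjOn (τ ω) ω.carrier ∧
    ∀ K : Set Y, IsCompact K → ((τ ω '' ω.carrier) ∩ K).Finite) :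
    (push τ ω).carrier = τ ω '' ω.carrier := by
  rw [push, dif_pos h]

/-- Injectivity makes all multiplicities of the image measure equal to 1. -/
lemma toMeasure_push {ω : Config X} (h : Set.InjOn (τ ω) ω.carrier ∧
    ∀ K : Set Y, IsCompact K → ((τ ω '' ω.carrier) ∩ K).Finite) :
    (push τ ω).toMeasure = imageMeasure τ ω := by
  ext B hB
  rw [toMeasure_apply _ hB, imageMeasure_apply τ ω hB, lintegral_toMeasure,
    ← tsum_image (fun y => B.indicator (1 : Y → ℝ≥0∞) y) h.1, ← carrier_push h,
    ← lintegral_toMeasure, lintegral_indicator_one hB, toMeasure_apply _ hB]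

lemma gen_push {ω : Config X} (h : Set.InjOn (τ ω) ω.carrier ∧
    ∀ K : Set Y, IsCompact K → ((τ ω '' ω.carrier) ∩ K).Finite) (f : Y → ℝ) :
    gen f (push τ ω) = ∏ᶠ x ∈ ω.carrier, f (τ ω x) := by
  rw [gen, carrier_push h, finprod_mem_image h.1]

lemma aemeasurable_push (hτ : Measurable (Function.uncurry τ))
    (h : ∀ᵐ ω ∂P, Set.InjOn (τ ω) ω.carrier ∧
      ∀ K : Set Y, IsCompact K → ((τ ω '' ω.carrier) ∩ K).Finite) :
    AEMeasurable (push τ) P := by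
  classical
  obtain ⟨N, hN, hNm, hNP⟩ := exists_measurable_superset_of_null (ae_iff.1 h)
  -- Off a measurable null set N the point measure of `push τ ω` is the image measure, which depends
  -- measurably on ω.
  refine ⟨fun ω => if ω ∈ N then empty else push τ ω, measurable_of_toMeasure ?_, ?_⟩
  · have : (fun ω : Config X => (if ω ∈ N then (empty : Config Y) else push τ ω).toMeasure) =
        fun ω => if ω ∈ N then (empty : Config Y).toMeasure else imageMeasure τ ω := by
      ext1 ω
      by_cases hω : ω ∈ N
      · simp only [if_pos hω]
      · simp only [if_neg hω]
        exact toMeasure_push (not_not.1 fun hcon => hω (hN hcon))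
    rw [this]
    exact Measurable.ite hNm measurable_const (measurable_imageMeasure hτ)
  · filter_upwards [measure_eq_zero_iff_ae_notMem.1 hNP] with ω hω
    rw [if_neg hω]

end Push

end Config

theorem theorem3p2 {X Y : Type*}
    [MetricSpace X] [SigmaCompactSpace X] [MeasurableSpace X] [BorelSpace X]
    [MetricSpace Y] [SigmaCompactSpace Y] [MeasurableSpace Y] [BorelSpace Y]
    (σ : Measure X) [IsFiniteMeasureOnCompacts σ] [NullSingletonClass σ]
    (μ : Measure Y) [IsFiniteMeasureOnCompacts μ] [NullSingletonClass μ]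
    (πσ : Measure (Config X)) (hπσ : Config.IsPoissonMeasure σ πσ)
    (τ : Config X → X → Y) (hτ : Measurable (Function.uncurry τ))
    (hpush : ∀ ω : Config X, σ.map (τ ω) = μ)
    (hcyclic : Config.CyclicCondition τ) :
    (∀ᵐ ω ∂πσ, (Config.push τ ω).toMeasure = Config.imageMeasure τ ω) ∧
    AEMeasurable (Config.push τ) πσ ∧
    Config.IsPoissonMeasure μ (πσ.map (Config.push τ)) ∧
    (∀ πμ : Measure (Config Y), Config.IsPoissonMeasure μ πμ → πσ.map (Config.push τ) = πμ) := by
  have hprob := hπσ.isProbabilityMeasure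
  have hae := hπσ.ae_injOn_and_finite hτ hpush hcyclic
  have hmeas : AEMeasurable (Config.push τ) πσ := Config.aemeasurable_push hτ hae
  have hprob' : IsProbabilityMeasure (πσ.map (Config.push τ)) :=
    Measure.isProbabilityMeasure_map hmeas
  have hgen : ∀ f : Y → ℝ, Config.IsTest f →
      ∫ ω, Config.gen f ω ∂(πσ.map (Config.push τ)) = Real.exp (-∫ y, (1 - f y) ∂μ) := by
    intro f hf
    rw [integral_map hmeas hf.measurable_gen.aestronglyMeasurable,
      ← hπσ.integral_finprod_image hτ hpush hcyclic hf]
    refine integral_congr_ae ?_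
    filter_upwards [hae] with ω hω
    exact Config.gen_push hω f
  refine ⟨hae.mono fun ω hω => Config.toMeasure_push hω, hmeas,
    Config.isPoissonMeasure_of_integral_gen hgen, fun πμ hπμ => ?_⟩
  have := hπμ.isProbabilityMeasure
  exact Config.ext_of_integral_gen fun f hf => by rw [hgen f hf, hπμ.integral_gen hf]
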